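/- Let $\mathcal Q$ be a small quantaloid, i.e. a small category enriched in complete lattices and supremum-preserving maps. Let $\mathcal Q_{si}$ be its split-idempotent completion: its objects are the idempotents of $\mathcal Q$, its arrows from $e\colon A\to A$ to $f\colon B\to B$ are the $g\colon A\to B$ with $g\circ e=g=f\circ g$, ordered as in $\mathcal Q$. Let $\mathsf{Ord}(\mathcal Q)=\mathsf{Cat}_{cc}(\mathcal Q_{si})$ be the locally ordered category of ordered sheaves on $\mathcal Q$: its objects are the Cauchy complete $\mathcal Q_{si}$-enriched categories (those for which every left adjoint distributor into them is represented by a functor), its morphisms are the $\mathcal Q_{si}$-enriched functors, and $F\le G$ means $1\le\mathbb B(Fa,Ga)$ for all objects $a$. Let $\mathsf{Mod}(\mathcal Q)$ be the quantaloid of $\mathcal Q$-modules, i.e. of sup-enriched functors $\mathcal F\colon\mathcal Q^{op}\to\mathsf{Sup}$ and sup-enriched natural transformations. For $a\in\mathcal F(A)$ let $\tau_a\colon\mathcal Q(-,A)\Rightarrow\mathcal F$ be the morphism $f\mapsto\mathcal F(f)(a)$, and for an idempotent $e\colon A\to A$ let $\sigma_e$ be the inclusion into $\mathcal Q(-,A)$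 of the module $\mathcal F_e=\{f\in\mathcal Q(-,A)\mid e\circ f=f\}$. The element $a$ is locally principal if there is an idempotent $e\colon A\to A$ with $\mathcal F(e)(a)=a$ such that $\tau_a\circ\sigma_e$ is a left adjoint in $\mathsf{Mod}(\mathcal Q)$; and $\mathcal F$ is locally principally generated if for every element $x$ of $\mathcal F$, $\tau_x=\bigvee\{\tau_a\circ[\tau_a,\tau_x]\mid a\text{ locally principal}\}$, where $[\tau_a,\tau_x]$ is the largest morphism $h$ with $\tau_a\circ h\le\tau_x$. Let $\mathsf{Map}(\mathsf{Mod}_{lpg}(\mathcal Q))$ be the locally ordered category of locally principally generated $\mathcal Q$-modules and left adjoint module morphisms between them, with the local order of $\mathsf{Mod}(\mathcal Q)$. Let $F\colon\mathsf{Ord}(\mathcal Q)\to\mathsf{Mod}(\mathcal Q)$ be the free-cocompletion 2-functor: it sends $\mathbb A$ to the $\mathcal Q_{si}$-module $X\mapsto\{\text{contravariant presheaves of type }X\text{ on }\mathbb A\}$, restricted along the inclusion $\mathcal Q\to\mathcal Q_{si}$, and a functor $G\colon\mathbb A\to\mathbb B$ to $\phi\mapsto\mathbb B(-,G-)\otimes\phi$.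 Let $U\colon\mathsf{Mod}(\mathcal Q)\to\mathsf{Ord}(\mathcal Q)$ be the forgetful 2-functor: it sends $\mathcal F$ to the $\mathcal Q_{si}$-category whose objects of type $e\colon A\to A$ are the $x\in\mathcal F(A)$ with $\mathcal F(e)(x)=x$, the hom-arrow from $x$ to $y$ being the supremum of all $f$ in $\mathcal Q_{si}$ from the type of $x$ to the type of $y$ with $\mathcal F(f)(y)\le x$. Then $F$ is left biadjoint to $U$, and $F$ factors as a biequivalence $\mathsf{Ord}(\mathcal Q)\simeq\mathsf{Map}(\mathsf{Mod}_{lpg}(\mathcal Q))$ followed by the inclusion $\mathsf{Map}(\mathsf{Mod}_{lpg}(\mathcal Q))\hookrightarrow\mathsf{Mod}(\mathcal Q)$. In particular, $\mathsf{Ord}(\mathcal Q)$ is biequivalent to $\mathsf{Map}(\mathsf{Mod}_{lpg}(\mathcal Q))$. -/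

import Mathlib

open CategoryTheory CategoryTheory.Idempotents

universe w w' v v' u u'

noncomputable section

namespace OrderedSheaves

/-! ## Locally ordered categories as 2-categories -/

/-- A locally ordered category: every hom-set carries an order (reflexive and transitive), and
composition is order-preserving in both variables. -/
class LocallyOrdered (C : Type u) [Category.{v} C] where
  homPreorder : ∀ X Y : C, Preorder (X ⟶ Y)
  comp_mono : ∀ {X Y Z : C} {f f' : X ⟶ Y} {g g' : Y ⟶ Z},
    f ≤ f' → g ≤ g' → f ≫ g ≤ f' ≫ g'

attribute [reducible, instance] LocallyOrdered.homPreorder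

/-- The 2-category underlying a locally ordered category: there is a (unique) 2-cell `f ⟶ g`
precisely when `f ≤ g`. -/
@[reducible]
def LocallyOrdered.toBicategory (C : Type u) [Category.{v} C] [LocallyOrdered C] :
    Bicategory.{v, v} C where
  homCategory X Y := Preorder.smallCategory (X ⟶ Y)
  whiskerLeft _ _ _ η := homOfLE (LocallyOrdered.comp_mono le_rfl (leOfHom η))
  whiskerRight η _ := homOfLE (LocallyOrdered.comp_mono (leOfHom η) le_rfl)
  associator := fun f g h => eqToIso (Category.assoc f g h)
  leftUnitor f := eqToIso (Category.id_comp f)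
  rightUnitor f := eqToIso (Category.comp_id f)
  whiskerLeft_id _ _ := Subsingleton.elim _ _
  whiskerLeft_comp _ _ _ _ _ _ := Subsingleton.elim _ _
  id_whiskerLeft _ := Subsingleton.elim _ _
  comp_whiskerLeft _ _ _ _ _ := Subsingleton.elim _ _
  id_whiskerRight _ _ := Subsingleton.elim _ _
  comp_whiskerRight _ _ _ := Subsingleton.elim _ _
  whiskerRight_id _ := Subsingleton.elim _ _
  whiskerRight_comp _ _ _ := Subsingleton.elim _ _
  whisker_assoc _ _ _ _ _ := Subsingleton.elim _ _
  whisker_exchange _ _ := Subsingleton.elim _ _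
  pentagon _ _ _ _ := Subsingleton.elim _ _
  triangle _ _ := Subsingleton.elim _ _

/-- An order-preserving functor between locally ordered categories is a 2-functor. -/
def LocallyOrdered.twoFunctor {C : Type u} [Category.{v} C] [LocallyOrdered C]
    {D : Type u'} [Category.{v'} D] [LocallyOrdered D] (F : C ⥤ D)
    (mono : ∀ {X Y : C} {f g : X ⟶ Y}, f ≤ g → F.map f ≤ F.map g) :
    letI := LocallyOrdered.toBicategory C
    letI := LocallyOrdered.toBicategory D
    Pseudofunctor C D :=
  letI := LocallyOrdered.toBicategory C
  letI := LocallyOrdered.toBicategory D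
  { obj := F.obj
    map := F.map
    map₂ := fun η => homOfLE (mono (leOfHom η))
    map₂_id := fun _ => Subsingleton.elim _ _
    map₂_comp := fun _ _ => Subsingleton.elim _ _
    mapId := fun X => eqToIso (F.map_id X)
    mapComp := fun f g => eqToIso (F.map_comp f g)
    map₂_whisker_left := fun _ _ _ _ => Subsingleton.elim _ _
    map₂_whisker_right := fun _ _ => Subsingleton.elim _ _
    map₂_associator := fun _ _ _ => Subsingleton.elim _ _
    map₂_left_unitor := fun _ => Subsingleton.elim _ _
    map₂_right_unitor := fun _ => Subsingleton.elim _ _ }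

open scoped Pseudofunctor.StrongTrans in
/-- A pseudofunctor is a biequivalence if it has an inverse up to pseudonatural equivalence. -/
def IsBiequivalence {B : Type u} [Bicategory.{w, v} B] {C : Type u'} [Bicategory.{w', v'} C]
    (E : Pseudofunctor B C) : Prop :=
  ∃ G : Pseudofunctor C B,
    Nonempty (Bicategory.Equivalence (Pseudofunctor.id B) (E.comp G)) ∧
    Nonempty (Bicategory.Equivalence (G.comp E) (Pseudofunctor.id C))

/-- `F` is left biadjoint to `U`: there is a pseudonatural unit `η : 1 ⟶ U F` such that
`g ↦ U g ∘ η_X` is an equivalence of categories from `C(F X, Y)` to `B(X, U Y)`,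
for all `X` and `Y`. -/
def IsLeftBiadjoint {B : Type u} [Bicategory.{w, v} B] {C : Type u'} [Bicategory.{w', v'} C]
    (F : Pseudofunctor B C) (U : Pseudofunctor C B) : Prop :=
  ∃ η : Pseudofunctor.StrongTrans (Pseudofunctor.id B) (F.comp U),
    ∀ (X : B) (Y : C),
      (U.mapFunctor (F.obj X) Y ⋙ Bicategory.precomp (U.obj Y) (η.app X)).IsEquivalence

/-! ## Quantaloids -/

/-- A quantaloid: a category enriched in complete lattices and supremum-preserving maps. -/
class Quantaloid (Q : Type u) [Category.{v} Q] where
  homLattice : ∀ X Y : Q, CompleteLattice (X ⟶ Y)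
  sSup_comp : ∀ {X Y Z : Q} (S : Set (X ⟶ Y)) (g : Y ⟶ Z), sSup S ≫ g = ⨆ f ∈ S, f ≫ g
  comp_sSup : ∀ {X Y Z : Q} (f : X ⟶ Y) (S : Set (Y ⟶ Z)), f ≫ sSup S = ⨆ g ∈ S, f ≫ g

attribute [reducible, instance] Quantaloid.homLattice

section Quantaloid

variable {Q : Type u} [Category.{v} Q] [Quantaloid Q]

theorem iSup_comp {ι : Sort*} {X Y Z : Q} (f : ι → (X ⟶ Y)) (g : Y ⟶ Z) :
    (⨆ i, f i) ≫ g = ⨆ i, f i ≫ g := by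
  rw [iSup, Quantaloid.sSup_comp, iSup_range]

theorem comp_iSup {ι : Sort*} {X Y Z : Q} (f : X ⟶ Y) (g : ι → (Y ⟶ Z)) :
    f ≫ (⨆ i, g i) = ⨆ i, f ≫ g i := by
  rw [iSup, Quantaloid.comp_sSup, iSup_range]

theorem comp_le_comp {X Y Z : Q} {f f' : X ⟶ Y} {g g' : Y ⟶ Z} (hf : f ≤ f') (hg : g ≤ g') :
    f ≫ g ≤ f' ≫ g' := by
  have h1 : f ≫ g ≤ f' ≫ g := by
    rw [← sup_eq_right.2 hf, ← sSup_pair, Quantaloid.sSup_comp, iSup_pair]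
    exact le_sup_left
  have h2 : f' ≫ g ≤ f' ≫ g' := by
    rw [← sup_eq_right.2 hg, ← sSup_pair, Quantaloid.comp_sSup, iSup_pair]
    exact le_sup_left
  exact h1.trans h2

instance Quantaloid.locallyOrdered : LocallyOrdered Q where
  homPreorder X Y := inferInstance
  comp_mono := comp_le_comp

/-- The lifting `[f, g]` of `g` through `f`. -/
def lifting {X Y A : Q} (f : X ⟶ Y) (g : A ⟶ Y) : A ⟶ X :=
  sSup {h | h ≫ f ≤ g}

/-- `f` is a left adjoint: there is `g` with `1 ≤ g ∘ f` and `f ∘ g ≤ 1`. -/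
def IsMap {X Y : Q} (f : X ⟶ Y) : Prop :=
  ∃ g : Y ⟶ X, 𝟙 X ≤ f ≫ g ∧ g ≫ f ≤ 𝟙 Y

theorem isMap_id (X : Q) : IsMap (𝟙 X) :=
  ⟨𝟙 X, by rw [Category.id_comp], by rw [Category.id_comp]⟩

theorem IsMap.comp {X Y Z : Q} {f : X ⟶ Y} {g : Y ⟶ Z} (hf : IsMap f) (hg : IsMap g) :
    IsMap (f ≫ g) := by
  obtain ⟨f', hf1, hf2⟩ := hf
  obtain ⟨g', hg1, hg2⟩ := hg
  refine ⟨g' ≫ f', ?_, ?_⟩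
  · calc 𝟙 X ≤ f ≫ 𝟙 Y ≫ f' := by rwa [Category.id_comp]
      _ ≤ f ≫ (g ≫ g') ≫ f' := comp_le_comp le_rfl (comp_le_comp hg1 le_rfl)
      _ = (f ≫ g) ≫ g' ≫ f' := by simp only [Category.assoc]
  · calc (g' ≫ f') ≫ f ≫ g = g' ≫ (f' ≫ f) ≫ g := by simp only [Category.assoc]
      _ ≤ g' ≫ 𝟙 Y ≫ g := comp_le_comp le_rfl (comp_le_comp hf2 le_rfl)
      _ ≤ 𝟙 Z := by rwa [Category.id_comp]

end Quantaloid

/-- The locally ordered category `Map(K)` of left adjoints in a quantaloid `K`: it has the objects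
of `K`, and its morphisms are the left adjoints of `K`, with the local order of `K`. -/
structure MapCat (K : Type u) where
  as : K

namespace MapCat

variable {K : Type u} [Category.{v} K] [Quantaloid K]

instance : Category.{v} (MapCat K) where
  Hom X Y := {f : X.as ⟶ Y.as // IsMap f}
  id X := ⟨𝟙 X.as, isMap_id X.as⟩
  comp f g := ⟨f.1 ≫ g.1, f.2.comp g.2⟩
  id_comp f := Subtype.ext (Category.id_comp f.1)
  comp_id f := Subtype.ext (Category.comp_id f.1)
  assoc f g h := Subtype.ext (Category.assoc f.1 g.1 h.1)

instance : LocallyOrdered (MapCat K) where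
  homPreorder X Y := inferInstanceAs (Preorder {f : X.as ⟶ Y.as // IsMap f})
  comp_mono hf hg := comp_le_comp (Q := K) hf hg

instance : Bicategory.{v, v} (MapCat K) := LocallyOrdered.toBicategory (MapCat K)

end MapCat

/-! ## The split-idempotent completion -/

section Karoubi

variable {Q : Type u} [Category.{v} Q] [Quantaloid Q]

instance karoubiHomOrder (d e : Karoubi Q) : PartialOrder (d ⟶ e) :=
  PartialOrder.lift (fun g => g.f) fun _ _ h => Karoubi.hom_ext _ _ h

instance karoubiHomSupSet (d e : Karoubi Q) : SupSet (d ⟶ e) where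
  sSup S := ⟨⨆ g ∈ S, g.f, by
    simp only [iSup_comp, comp_iSup, Karoubi.comp_p, Karoubi.p_comp]⟩

theorem karoubi_sSup_f {d e : Karoubi Q} (S : Set (d ⟶ e)) : (sSup S).f = ⨆ g ∈ S, g.f := rfl

theorem karoubi_isLUB {d e : Karoubi Q} (S : Set (d ⟶ e)) : IsLUB S (sSup S) := by
  constructor
  · intro g hg
    exact le_iSup₂ (f := fun (g : d ⟶ e) (_ : g ∈ S) => g.f) g hg
  · intro g hg
    exact iSup₂_le fun h hh => hg hh

instance karoubiHomLattice (d e : Karoubi Q) : CompleteLattice (d ⟶ e) :=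
  completeLatticeOfSup _ karoubi_isLUB

theorem karoubi_iSup_f {ι : Sort*} {d e : Karoubi Q} (g : ι → (d ⟶ e)) :
    (⨆ i, g i).f = ⨆ i, (g i).f := by
  rw [iSup]
  exact (karoubi_sSup_f _).trans iSup_range

/-- The split-idempotent completion of a quantaloid, with the local order of the quantaloid. -/
instance : Quantaloid (Karoubi Q) where
  homLattice := karoubiHomLattice
  sSup_comp S g := by
    apply Karoubi.hom_ext
    simp only [Karoubi.comp_f, karoubi_iSup_f, karoubi_sSup_f, iSup_comp]
  comp_sSup f S := by
    apply Karoubi.hom_ext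
    simp only [Karoubi.comp_f, karoubi_iSup_f, karoubi_sSup_f, comp_iSup]

end Karoubi

/-! ## Modules on a small quantaloid -/

/-- A module on a small quantaloid `Q`: a `Sup`-enriched functor `Qᵒᵖ ⥤ Sup`. -/
structure QMod (Q : Type u) [Category.{u} Q] [Quantaloid Q] where
  obj : Q → Type u
  lattice : ∀ X, CompleteLattice (obj X)
  map : ∀ {X Y : Q}, (X ⟶ Y) → obj Y → obj X
  map_sSup : ∀ {X Y : Q} (f : X ⟶ Y) (S : Set (obj Y)), map f (sSup S) = ⨆ y ∈ S, map f y
  sSup_map : ∀ {X Y : Q} (S : Set (X ⟶ Y)) (y : obj Y), map (sSup S) y = ⨆ f ∈ S, map f y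
  map_id : ∀ {X : Q} (x : obj X), map (𝟙 X) x = x
  map_comp : ∀ {X Y Z : Q} (f : X ⟶ Y) (g : Y ⟶ Z) (z : obj Z), map (f ≫ g) z = map f (map g z)

attribute [instance] QMod.lattice

namespace QMod

variable {Q : Type u} [Category.{u} Q] [Quantaloid Q]

/-- A module morphism: a natural transformation whose components preserve suprema. -/
@[ext]
structure Hom (M N : QMod Q) where
  app : ∀ X, M.obj X → N.obj X
  map_sSup : ∀ (X : Q) (S : Set (M.obj X)), app X (sSup S) = ⨆ x ∈ S, app X x
  naturality : ∀ {X Y : Q} (f : X ⟶ Y) (y : M.obj Y), app X (M.map f y) = N.map f (app Y y)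

theorem map_iSup {ι : Sort*} (M : QMod Q) {X Y : Q} (f : X ⟶ Y) (y : ι → M.obj Y) :
    M.map f (⨆ i, y i) = ⨆ i, M.map f (y i) := by
  rw [iSup, M.map_sSup, iSup_range]

theorem iSup_map {ι : Sort*} (M : QMod Q) {X Y : Q} (f : ι → (X ⟶ Y)) (y : M.obj Y) :
    M.map (⨆ i, f i) y = ⨆ i, M.map (f i) y := by
  rw [iSup, M.sSup_map, iSup_range]

theorem map_mono (M : QMod Q) {X Y : Q} {f g : X ⟶ Y} {y z : M.obj Y} (hf : f ≤ g) (hy : y ≤ z) :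
    M.map f y ≤ M.map g z := by
  have h1 : M.map f y ≤ M.map g y := by
    rw [← sup_eq_right.2 hf, ← sSup_pair, M.sSup_map, iSup_pair]
    exact le_sup_left
  have h2 : M.map g y ≤ M.map g z := by
    rw [← sup_eq_right.2 hy, ← sSup_pair, M.map_sSup, iSup_pair]
    exact le_sup_left
  exact h1.trans h2

theorem Hom.map_iSup {ι : Sort*} {M N : QMod Q} (α : Hom M N) {X : Q} (x : ι → M.obj X) :
    α.app X (⨆ i, x i) = ⨆ i, α.app X (x i) := by
  rw [iSup, α.map_sSup, iSup_range]

theorem Hom.mono {M N : QMod Q} (α : Hom M N) {X : Q} {x y : M.obj X} (h : x ≤ y) :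
    α.app X x ≤ α.app X y := by
  rw [← sup_eq_right.2 h, ← sSup_pair, α.map_sSup, iSup_pair]
  exact le_sup_left

instance : Category.{u} (QMod Q) where
  Hom := Hom
  id M :=
    { app := fun _ x => x
      map_sSup := fun _ _ => sSup_eq_iSup
      naturality := fun _ _ => rfl }
  comp α β :=
    { app := fun X x => β.app X (α.app X x)
      map_sSup := fun X S => by simp only [α.map_sSup, β.map_iSup]
      naturality := fun f y => by simp only [α.naturality, β.naturality] }

theorem hom_ext {M N : QMod Q} {α β : M ⟶ N} (h : ∀ X x, α.app X x = β.app X x) : α = β :=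
  Hom.ext (funext fun X => funext fun x => h X x)

theorem id_app (M : QMod Q) (X : Q) (x : M.obj X) : Hom.app (𝟙 M) X x = x := rfl

theorem comp_app {M N P : QMod Q} (α : M ⟶ N) (β : N ⟶ P) (X : Q) (x : M.obj X) :
    (α ≫ β).app X x = β.app X (α.app X x) := rfl

/-- Module morphisms are ordered pointwise. -/
instance homOrder (M N : QMod Q) : PartialOrder (M ⟶ N) :=
  PartialOrder.lift (fun α X x => α.app X x) fun _ _ h => Hom.ext h

instance homSupSet (M N : QMod Q) : SupSet (M ⟶ N) where
  sSup S :=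
    { app := fun X x => ⨆ α ∈ S, α.app X x
      map_sSup := fun X T => by
        simp only [Hom.map_sSup]
        apply le_antisymm
        · exact iSup₂_le fun α hα => iSup₂_le fun x hx =>
            le_iSup₂_of_le x hx (le_iSup₂ (f := fun (α : M ⟶ N) (_ : α ∈ S) => α.app X x) α hα)
        · exact iSup₂_le fun x hx => iSup₂_le fun α hα =>
            le_iSup₂_of_le α hα (le_iSup₂ (f := fun (x : M.obj X) (_ : x ∈ T) => α.app X x) x hx)
      naturality := fun f y => by simp only [Hom.naturality, N.map_iSup] }

theorem sSup_app {M N : QMod Q} (S : Set (M ⟶ N)) (X : Q) (x : M.obj X) :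
    (sSup S).app X x = ⨆ α ∈ S, α.app X x := rfl

theorem hom_isLUB {M N : QMod Q} (S : Set (M ⟶ N)) : IsLUB S (sSup S) := by
  constructor
  · intro α hα X x
    exact le_iSup₂ (f := fun (α : M ⟶ N) (_ : α ∈ S) => α.app X x) α hα
  · intro β hβ X x
    exact iSup₂_le fun α hα => hβ hα X x

instance homLattice (M N : QMod Q) : CompleteLattice (M ⟶ N) :=
  completeLatticeOfSup _ hom_isLUB

theorem iSup_app {ι : Sort*} {M N : QMod Q} (α : ι → (M ⟶ N)) (X : Q) (x : M.obj X) :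
    (⨆ i, α i).app X x = ⨆ i, (α i).app X x := by
  rw [iSup]
  exact (sSup_app _ _ _).trans iSup_range

/-- The quantaloid of modules on `Q`. -/
instance : Quantaloid (QMod Q) where
  homLattice := homLattice
  sSup_comp S β := hom_ext fun X x => by
    simp only [comp_app, iSup_app, sSup_app, Hom.map_iSup]
  comp_sSup α S := hom_ext fun X x => by
    simp only [comp_app, iSup_app, sSup_app]

instance : Bicategory.{u, u} (QMod Q) := LocallyOrdered.toBicategory (QMod Q)

/-- The representable module `Q(-, A)`. -/
def representable (A : Q) : QMod Q where
  obj X := X ⟶ A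
  lattice _ := inferInstance
  map f g := f ≫ g
  map_sSup f S := Quantaloid.comp_sSup f S
  sSup_map S g := Quantaloid.sSup_comp S g
  map_id g := Category.id_comp g
  map_comp f g h := Category.assoc f g h

/-- The morphism `τ_a : Q(-, A) ⟶ M` that corresponds to the element `a` of `M A`. -/
def tau (M : QMod Q) {A : Q} (a : M.obj A) : representable A ⟶ M where
  app _ f := M.map f a
  map_sSup _ S := M.sSup_map S a
  naturality f g := M.map_comp f g a

/-- Restriction of modules along the inclusion `Q ⟶ Q_si`. -/
def restrict : QMod (Karoubi Q) ⥤ QMod Q where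
  obj M :=
    { obj := fun X => M.obj ((toKaroubi Q).obj X)
      lattice := fun _ => inferInstance
      map := fun f => M.map ((toKaroubi Q).map f)
      map_sSup := fun f S => M.map_sSup _ S
      sSup_map := fun S y => by
        have h : (toKaroubi Q).map (sSup S) = ⨆ f ∈ S, (toKaroubi Q).map f := by
          apply Karoubi.hom_ext
          simp only [karoubi_iSup_f, toKaroubi_map_f, sSup_eq_iSup]
        rw [h]
        simp only [M.iSup_map]
      map_id := fun x => by rw [(toKaroubi Q).map_id, M.map_id]
      map_comp := fun f g z => by rw [(toKaroubi Q).map_comp, M.map_comp] }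
  map α :=
    { app := fun X => α.app ((toKaroubi Q).obj X)
      map_sSup := fun X S => α.map_sSup _ S
      naturality := fun f y => α.naturality _ y }

/-- The fixpoint module `F_e = Q_si(j-, e)` of an idempotent `e : A ⟶ A`. -/
def fixpoint (e : Karoubi Q) : QMod Q := restrict.obj (representable e)

/-- The inclusion `σ_e : F_e ⟶ Q(-, A)`. -/
def sigma (e : Karoubi Q) : fixpoint e ⟶ representable e.X where
  app _ g := Karoubi.Hom.f g
  map_sSup _ S := karoubi_sSup_f S
  naturality _ _ := rfl

/-- `a` is locally principal if there is an idempotent `e` with `M(e)(a) = a` such that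
`τ_a ∘ σ_e` is a left adjoint. -/
def IsLocallyPrincipal (M : QMod Q) {A : Q} (a : M.obj A) : Prop :=
  ∃ (e : A ⟶ A) (he : e ≫ e = e), M.map e a = a ∧ IsMap (sigma ⟨A, e, he⟩ ≫ M.tau a)

/-- `M` is locally principally generated if every `τ_x` is the supremum of all `τ_a ∘ [τ_a, τ_x]`
with `a` locally principal. -/
def IsLocallyPrincipallyGenerated (M : QMod Q) : Prop :=
  ∀ {X : Q} (x : M.obj X), M.tau x =
    sSup {t | ∃ (A : Q) (a : M.obj A),
      M.IsLocallyPrincipal a ∧ t = lifting (M.tau a) (M.tau x) ≫ M.tau a}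

end QMod

/-- The full subquantaloid of `QMod Q` on the locally principally generated modules. -/
structure ModLpg (Q : Type u) [Category.{u} Q] [Quantaloid Q] where
  module : QMod Q
  lpg : module.IsLocallyPrincipallyGenerated

namespace ModLpg

variable {Q : Type u} [Category.{u} Q] [Quantaloid Q]

instance : Category.{u} (ModLpg Q) where
  Hom M N := M.module ⟶ N.module
  id M := 𝟙 M.module
  comp α β := α ≫ β

instance : Quantaloid (ModLpg Q) where
  homLattice M N := QMod.homLattice M.module N.module
  sSup_comp S β := Quantaloid.sSup_comp (Q := QMod Q) S β
  comp_sSup α S := Quantaloid.comp_sSup (Q := QMod Q) α S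

end ModLpg

/-- `Map(Mod_lpg(Q))`: locally principally generated modules and left adjoint module morphisms. -/
abbrev MapModLpg (Q : Type u) [Category.{u} Q] [Quantaloid Q] := MapCat (ModLpg Q)

/-- The inclusion 2-functor of `Map(Mod_lpg(Q))` into `Mod(Q)`. -/
def inclusion (Q : Type u) [Category.{u} Q] [Quantaloid Q] :
    Pseudofunctor (MapModLpg Q) (QMod Q) :=
  LocallyOrdered.twoFunctor
    { obj := fun M => M.as.module
      map := fun α => α.1
      map_id := fun _ => rfl
      map_comp := fun _ _ => rfl }
    (fun h => h)

/-! ## Categories enriched in a small quantaloid -/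

/-- A `Q`-category. The set of objects with its type function `t : A₀ → Q₀` is given by its
fibres: `obj X` is the set of objects of type `X`. The hom-arrow `hom a' a` goes from `t a`
to `t a'`. -/
structure QCat (Q : Type u) [Category.{u} Q] [Quantaloid Q] where
  obj : Q → Type u
  hom : ∀ {X' X : Q}, obj X' → obj X → (X ⟶ X')
  comp_le : ∀ {X'' X' X : Q} (a'' : obj X'') (a' : obj X') (a : obj X),
    hom a' a ≫ hom a'' a' ≤ hom a'' a
  id_le : ∀ {X : Q} (a : obj X), 𝟙 X ≤ hom a a

namespace QCat

variable {Q : Type u} [Category.{u} Q] [Quantaloid Q]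

/-- A functor between `Q`-categories: a type-preserving map that increases the hom-arrows. -/
@[ext]
structure Hom (A B : QCat Q) where
  app : ∀ {X : Q}, A.obj X → B.obj X
  hom_le : ∀ {X' X : Q} (a' : A.obj X') (a : A.obj X), A.hom a' a ≤ B.hom (app a') (app a)

instance : Category.{u} (QCat Q) where
  Hom := Hom
  id A := { app := fun a => a, hom_le := fun _ _ => le_rfl }
  comp F G :=
    { app := fun a => G.app (F.app a)
      hom_le := fun a' a => (F.hom_le a' a).trans (G.hom_le _ _) }

/-- The local order: `F ≤ G` if `1 ≤ B(F a, G a)` for all objects `a`. -/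
instance (A B : QCat Q) : Preorder (A ⟶ B) where
  le F G := ∀ {X : Q} (a : A.obj X), 𝟙 X ≤ B.hom (F.app a) (G.app a)
  le_refl F := fun a => B.id_le _
  le_trans F G H h1 h2 := fun {X} a =>
    calc 𝟙 X = 𝟙 X ≫ 𝟙 X := (Category.id_comp _).symm
      _ ≤ B.hom (G.app a) (H.app a) ≫ B.hom (F.app a) (G.app a) := comp_le_comp (h2 a) (h1 a)
      _ ≤ B.hom (F.app a) (H.app a) := B.comp_le _ _ _

theorem le_def {A B : QCat Q} {F G : A ⟶ B} :
    F ≤ G ↔ ∀ {X : Q} (a : A.obj X), 𝟙 X ≤ B.hom (F.app a) (G.app a) := Iff.rfl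

instance : LocallyOrdered (QCat Q) where
  homPreorder A B := inferInstance
  comp_mono {A B C F F' G G'} hF hG := fun {X} a =>
    calc 𝟙 X = 𝟙 X ≫ 𝟙 X := (Category.id_comp _).symm
      _ ≤ C.hom (G.app (F'.app a)) (G'.app (F'.app a)) ≫ C.hom (G.app (F.app a)) (G.app (F'.app a)) :=
        comp_le_comp (hG _) ((hF a).trans (G.hom_le _ _))
      _ ≤ C.hom (G.app (F.app a)) (G'.app (F'.app a)) := C.comp_le _ _ _

/-- A distributor `Φ` from `A` to `B`, with elements `Φ(b, a) : t a ⟶ t b`. -/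
structure Distributor (A B : QCat Q) where
  elt : ∀ {Y X : Q}, B.obj Y → A.obj X → (X ⟶ Y)
  hom_left : ∀ {Y Y' X : Q} (b : B.obj Y) (b' : B.obj Y') (a : A.obj X),
    elt b' a ≫ B.hom b b' ≤ elt b a
  hom_right : ∀ {Y X X' : Q} (b : B.obj Y) (a' : A.obj X') (a : A.obj X),
    A.hom a' a ≫ elt b a' ≤ elt b a

/-- The elements of the composite distributor `Ψ ⊗ Φ`. -/
def Distributor.compElt {A B C : QCat Q} (Ψ : Distributor B C) (Φ : Distributor A B)
    {Z X : Q} (c : C.obj Z) (a : A.obj X) : X ⟶ Z :=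
  ⨆ (Y : Q) (b : B.obj Y), Φ.elt b a ≫ Ψ.elt c b

/-- `Φ` is a left adjoint (a Cauchy distributor): there is a distributor `Ψ` in the other
direction with `A ≤ Ψ ⊗ Φ` and `Φ ⊗ Ψ ≤ B`. -/
def Distributor.IsCauchy {A B : QCat Q} (Φ : Distributor A B) : Prop :=
  ∃ Ψ : Distributor B A,
    (∀ {X' X : Q} (a' : A.obj X') (a : A.obj X), A.hom a' a ≤ Ψ.compElt Φ a' a) ∧
    (∀ {Y' Y : Q} (b' : B.obj Y') (b : B.obj Y), Φ.compElt Ψ b' b ≤ B.hom b' b)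

/-- `C` is Cauchy complete: every left adjoint distributor into `C` is represented by a functor. -/
def IsCauchyComplete (C : QCat Q) : Prop :=
  ∀ (A : QCat Q) (Φ : Distributor A C), Φ.IsCauchy →
    ∃ F : A ⟶ C, ∀ {Y X : Q} (c : C.obj Y) (a : A.obj X), Φ.elt c a = C.hom c (F.app a)

/-- A contravariant presheaf of type `X` on `A`: a distributor to `A` from the one-object
`Q`-category whose only hom-arrow is the identity of `X`. -/
@[ext]
structure Presheaf (A : QCat Q) (X : Q) where
  elt : ∀ {Y : Q}, A.obj Y → (X ⟶ Y)
  hom_left : ∀ {Y Y' : Q} (a : A.obj Y) (a' : A.obj Y'), elt a' ≫ A.hom a a' ≤ elt a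

namespace Presheaf

variable {A : QCat Q}

instance (X : Q) : PartialOrder (Presheaf A X) :=
  PartialOrder.lift (fun φ (Y : Q) (a : A.obj Y) => φ.elt a) fun _ _ h => Presheaf.ext h

instance (X : Q) : SupSet (Presheaf A X) where
  sSup S :=
    { elt := fun a => ⨆ φ ∈ S, φ.elt a
      hom_left := fun a a' => by
        simp only [iSup_comp]
        exact iSup₂_mono fun φ _ => φ.hom_left a a' }

theorem sSup_elt {X : Q} (S : Set (Presheaf A X)) {Y : Q} (a : A.obj Y) :
    (sSup S).elt a = ⨆ φ ∈ S, φ.elt a := rfl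

theorem isLUB {X : Q} (S : Set (Presheaf A X)) : IsLUB S (sSup S) := by
  constructor
  · intro φ hφ Y a
    exact le_iSup₂ (f := fun (φ : Presheaf A X) (_ : φ ∈ S) => φ.elt a) φ hφ
  · intro ψ hψ Y a
    exact iSup₂_le fun φ hφ => hψ hφ Y a

instance (X : Q) : CompleteLattice (Presheaf A X) := completeLatticeOfSup _ isLUB

theorem iSup_elt {ι : Sort*} {X : Q} (φ : ι → Presheaf A X) {Y : Q} (a : A.obj Y) :
    (⨆ i, φ i).elt a = ⨆ i, (φ i).elt a := by
  rw [iSup]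
  exact (sSup_elt _ _).trans iSup_range

end Presheaf

/-- The free cocompletion `P A` of a `Q`-category `A`, as a module on `Q`: the elements of type `X`
are the presheaves of type `X`, and arrows act by tensoring, `φ ⊗ f = φ ∘ f`. -/
def presheafMod (A : QCat Q) : QMod Q where
  obj X := Presheaf A X
  lattice _ := inferInstance
  map f φ :=
    { elt := fun a => f ≫ φ.elt a
      hom_left := fun a a' => by
        rw [Category.assoc]
        exact comp_le_comp le_rfl (φ.hom_left a a') }
  map_sSup f S := by
    ext Y a
    simp only [Presheaf.iSup_elt, Presheaf.sSup_elt, comp_iSup]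
  sSup_map S φ := by
    ext Y a
    simp only [Presheaf.iSup_elt, Quantaloid.sSup_comp]
  map_id φ := by
    ext Y a
    exact Category.id_comp _
  map_comp f g φ := by
    ext Y a
    exact Category.assoc _ _ _

/-- A presheaf satisfies `⋁ₐ A(b, a) ∘ φ(a) = φ(b)`. -/
theorem Presheaf.iSup_hom {A : QCat Q} {X : Q} (φ : Presheaf A X) {Y : Q} (b : A.obj Y) :
    (⨆ (Z : Q) (a : A.obj Z), φ.elt a ≫ A.hom b a) = φ.elt b := by
  apply le_antisymm
  · exact iSup₂_le fun Z a => φ.hom_left b a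
  · calc φ.elt b = φ.elt b ≫ 𝟙 Y := (Category.comp_id _).symm
      _ ≤ φ.elt b ≫ A.hom b b := comp_le_comp le_rfl (A.id_le b)
      _ ≤ _ := le_iSup₂ (f := fun (Z : Q) (a : A.obj Z) => φ.elt a ≫ A.hom b a) Y b

/-- The module morphism `P F = B(-, F-) ⊗ - : P A ⟶ P B` for a functor `F : A ⟶ B`. -/
def presheafMap {A B : QCat Q} (F : A ⟶ B) : presheafMod A ⟶ presheafMod B where
  app X φ :=
    { elt := fun b => ⨆ (Z : Q) (a : A.obj Z), φ.elt a ≫ B.hom b (F.app a)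
      hom_left := fun b b' => by
        simp only [iSup_comp, Category.assoc]
        exact iSup₂_mono fun Z a => comp_le_comp le_rfl (B.comp_le _ _ _) }
  map_sSup X S := by
    refine Presheaf.ext (funext fun Y => funext fun b => ?_)
    change (⨆ (Z : Q) (a : A.obj Z), (sSup S : Presheaf A X).elt a ≫ B.hom b (F.app a)) = _
    refine Eq.trans ?_ (Presheaf.iSup_elt (A := B) (X := X) _ b).symm
    refine Eq.trans ?_ (iSup_congr fun φ => (Presheaf.iSup_elt (A := B) (X := X) _ b).symm)
    refine (iSup_congr fun Z => iSup_congr fun a => congrArg (· ≫ B.hom b (F.app a))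
      (Presheaf.sSup_elt (A := A) (X := X) S a)).trans ?_
    simp only [iSup_comp]
    apply le_antisymm
    · refine iSup₂_le fun Z a => iSup₂_le fun φ hφ => le_iSup₂_of_le φ hφ ?_
      exact le_iSup₂ (f := fun (Z : Q) (a : A.obj Z) => φ.elt a ≫ B.hom b (F.app a)) Z a
    · refine iSup₂_le fun φ hφ => iSup₂_le fun Z a => le_iSup₂_of_le Z a ?_
      exact le_iSup₂ (f := fun (φ : Presheaf A X) (_ : φ ∈ S) => φ.elt a ≫ B.hom b (F.app a)) φ hφ
  naturality f φ := by
    refine Presheaf.ext (funext fun Y => funext fun b => ?_)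
    change (⨆ (Z : Q) (a : A.obj Z), (f ≫ φ.elt a) ≫ B.hom b (F.app a)) =
      f ≫ ⨆ (Z : Q) (a : A.obj Z), φ.elt a ≫ B.hom b (F.app a)
    simp only [comp_iSup, Category.assoc]

/-- The 2-functor `A ↦ P A`, `F ↦ B(-, F-) ⊗ -`, with values in modules. -/
def presheafFunctor : QCat Q ⥤ QMod Q where
  obj := presheafMod
  map := presheafMap
  map_id A := QMod.hom_ext fun X φ => Presheaf.ext (funext fun Y => funext fun b =>
    Presheaf.iSup_hom φ b)
  map_comp {A B C} F G := QMod.hom_ext fun X φ => Presheaf.ext (funext fun Y => funext fun c => by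
    change (⨆ (Z : Q) (a : A.obj Z), φ.elt a ≫ C.hom c (G.app (F.app a))) =
      ⨆ (W : Q) (b : B.obj W), (⨆ (Z : Q) (a : A.obj Z), φ.elt a ≫ B.hom b (F.app a)) ≫
        C.hom c (G.app b)
    simp only [iSup_comp, Category.assoc]
    apply le_antisymm
    · refine iSup₂_le fun Z a => le_iSup₂_of_le Z (F.app a) (le_iSup₂_of_le Z a ?_)
      calc φ.elt a ≫ C.hom c (G.app (F.app a))
          = φ.elt a ≫ 𝟙 Z ≫ C.hom c (G.app (F.app a)) := by rw [Category.id_comp]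
        _ ≤ _ := comp_le_comp le_rfl (comp_le_comp (B.id_le _) le_rfl)
    · refine iSup₂_le fun W b => iSup₂_le fun Z a => le_iSup₂_of_le Z a ?_
      exact comp_le_comp le_rfl ((comp_le_comp (G.hom_le _ _) le_rfl).trans (C.comp_le _ _ _)))

theorem presheafMap_mono {A B : QCat Q} {F G : A ⟶ B} (h : F ≤ G) :
    presheafMap F ≤ presheafMap G := fun X φ Y b =>
  iSup₂_mono fun Z a => comp_le_comp le_rfl <|
    calc B.hom b (F.app a) = 𝟙 Z ≫ B.hom b (F.app a) := (Category.id_comp _).symm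
      _ ≤ B.hom (F.app a) (G.app a) ≫ B.hom b (F.app a) := comp_le_comp (h a) le_rfl
      _ ≤ B.hom b (G.app a) := B.comp_le _ _ _

end QCat

/-- The full sub-2-category of Cauchy complete `Q`-categories. -/
structure CatCC (Q : Type u) [Category.{u} Q] [Quantaloid Q] where
  cat : QCat Q
  cauchyComplete : cat.IsCauchyComplete

namespace CatCC

variable {Q : Type u} [Category.{u} Q] [Quantaloid Q]

instance : Category.{u} (CatCC Q) where
  Hom A B := A.cat ⟶ B.cat
  id A := 𝟙 A.cat
  comp F G := F ≫ G

instance : LocallyOrdered (CatCC Q) where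
  homPreorder A B := inferInstanceAs (Preorder (A.cat ⟶ B.cat))
  comp_mono hf hg := LocallyOrdered.comp_mono (C := QCat Q) hf hg

instance : Bicategory.{u, u} (CatCC Q) := LocallyOrdered.toBicategory (CatCC Q)

end CatCC

/-- The locally ordered category `Ord(Q)` of ordered sheaves on `Q`: Cauchy complete categories
enriched in the split-idempotent completion of `Q`. -/
abbrev OrdSheaf (Q : Type u) [Category.{u} Q] [Quantaloid Q] := CatCC (Karoubi Q)

/-- The free-cocompletion 2-functor `F : Ord(Q) ⟶ Mod(Q)`, which sends an ordered sheaf on `Q` to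
its `Q_si`-module of presheaves, restricted to `Q`. -/
def freeCocompletion (Q : Type u) [Category.{u} Q] [Quantaloid Q] :
    Pseudofunctor (OrdSheaf Q) (QMod Q) :=
  LocallyOrdered.twoFunctor
    { obj := fun A => QMod.restrict.obj (QCat.presheafMod A.cat)
      map := fun F => QMod.restrict.map (QCat.presheafMap F)
      map_id := fun A => by
        rw [← QMod.restrict.map_id]
        exact congrArg QMod.restrict.map (QCat.presheafFunctor.map_id A.cat)
      map_comp := fun F G => by
        rw [← QMod.restrict.map_comp]
        exact congrArg QMod.restrict.map (QCat.presheafFunctor.map_comp F G) }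
    (fun h X φ => QCat.presheafMap_mono h ((toKaroubi Q).obj X) φ)

/-! ## The ordered sheaf underlying a module -/

namespace QMod

variable {Q : Type u} [Category.{u} Q] [Quantaloid Q]

/-- The elements `x` of `M A` with `M(e)(x) = x`, for an idempotent `e : A ⟶ A`. -/
def Fix (M : QMod Q) (e : Karoubi Q) : Type u := {x : M.obj e.X // M.map e.p x = x}

instance (M : QMod Q) (e : Karoubi Q) : PartialOrder (M.Fix e) :=
  inferInstanceAs (PartialOrder {x : M.obj e.X // M.map e.p x = x})

instance (M : QMod Q) (e : Karoubi Q) : SupSet (M.Fix e) where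
  sSup S := ⟨⨆ x ∈ S, x.1, by
    simp only [M.map_iSup]
    exact iSup_congr fun x => iSup_congr fun _ => x.2⟩

theorem Fix.sSup_val {M : QMod Q} {e : Karoubi Q} (S : Set (M.Fix e)) :
    (sSup S).1 = ⨆ x ∈ S, x.1 := rfl

theorem Fix.isLUB {M : QMod Q} {e : Karoubi Q} (S : Set (M.Fix e)) : IsLUB S (sSup S) := by
  constructor
  · intro x hx
    exact le_iSup₂ (f := fun (x : M.Fix e) (_ : x ∈ S) => x.1) x hx
  · intro y hy
    exact iSup₂_le fun x hx => hy hx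

instance (M : QMod Q) (e : Karoubi Q) : CompleteLattice (M.Fix e) :=
  completeLatticeOfSup _ Fix.isLUB

theorem Fix.iSup_val {ι : Sort*} {M : QMod Q} {e : Karoubi Q} (x : ι → M.Fix e) :
    (⨆ i, x i).1 = ⨆ i, (x i).1 := by
  rw [iSup]
  exact (Fix.sSup_val _).trans iSup_range

/-- The `Q_si`-module `M_si` associated to a `Q`-module `M`. -/
def si (M : QMod Q) : QMod (Karoubi Q) where
  obj e := M.Fix e
  lattice _ := inferInstance
  map {d e} f x := ⟨M.map f.f x.1, by rw [← M.map_comp, Karoubi.p_comp]⟩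
  map_sSup f S := Subtype.ext (by
    rw [Fix.iSup_val]
    refine Eq.trans ?_ (iSup_congr fun x => (Fix.iSup_val (M := M) _).symm)
    simp only [Fix.sSup_val, M.map_iSup])
  sSup_map S x := Subtype.ext (by
    rw [Fix.iSup_val]
    refine Eq.trans ?_ (iSup_congr fun f => (Fix.iSup_val (M := M) _).symm)
    simp only [karoubi_sSup_f, M.iSup_map])
  map_id x := Subtype.ext x.2
  map_comp f g x := Subtype.ext (M.map_comp f.f g.f x.1)

/-- The `Q_si`-module morphism `α_si` associated to a `Q`-module morphism `α`. -/
def siMap {M N : QMod Q} (α : M ⟶ N) : M.si ⟶ N.si where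
  app e x := ⟨α.app e.X x.1, by rw [← α.naturality, x.2]⟩
  map_sSup e S := Subtype.ext (by
    refine Eq.trans ?_ (Fix.iSup_val (M := N) (e := e) _).symm
    refine Eq.trans ?_ (iSup_congr fun x => (Fix.iSup_val (M := N) (e := e) _).symm)
    refine (congrArg (α.app e.X) (Fix.sSup_val (M := M) (e := e) S)).trans ?_
    simp only [Hom.map_iSup]
    rfl)
  naturality f x := Subtype.ext (α.naturality f.f x.1)

/-- The cocomplete `Q`-category `A_M` of elements of a module `M`, with
`A_M(y, x) = ⋁ {f : t x ⟶ t y | M(f)(y) ≤ x}`. -/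
def elements (M : QMod Q) : QCat Q where
  obj X := M.obj X
  hom y x := sSup {f | M.map f y ≤ x}
  comp_le {X'' X' X} z y x := by
    rw [Quantaloid.sSup_comp]
    refine iSup₂_le fun f hf => ?_
    rw [Quantaloid.comp_sSup]
    refine iSup₂_le fun g hg => le_sSup ?_
    change M.map (f ≫ g) z ≤ x
    rw [M.map_comp]
    exact (M.map_mono le_rfl hg).trans hf
  id_le x := le_sSup (M.map_id x).le

theorem le_elements_hom {M : QMod Q} {X Y : Q} {y : M.obj Y} {x : M.obj X} {f : X ⟶ Y} :
    f ≤ M.elements.hom y x ↔ M.map f y ≤ x := by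
  constructor
  · intro h
    refine (M.map_mono h le_rfl).trans ?_
    change M.map (sSup {f | M.map f y ≤ x}) y ≤ x
    rw [M.sSup_map]
    exact iSup₂_le fun g hg => hg
  · intro h
    exact le_sSup h

/-- The functor between the `Q`-categories of elements induced by a module morphism. -/
def elementsMap {M N : QMod Q} (α : M ⟶ N) : M.elements ⟶ N.elements where
  app x := α.app _ x
  hom_le y x := le_elements_hom.2
    ((α.naturality (M.elements.hom y x) y).symm.le.trans (α.mono (le_elements_hom.1 le_rfl)))

theorem elements_isCauchyComplete (M : QMod Q) : M.elements.IsCauchyComplete := by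
  intro A Φ hΦ
  obtain ⟨Ψ, h1, h2⟩ := hΦ
  let K : ∀ {X : Q}, A.obj X → M.obj X := fun {X} a =>
    ⨆ (Y : Q) (y : M.obj Y), M.map (Φ.elt (B := M.elements) (Y := Y) y a) y
  have hK : ∀ {X Y : Q} (a : A.obj X) (y : M.obj Y),
      Φ.elt (B := M.elements) (Y := Y) y a ≤ M.elements.hom y (K a) := fun {X Y} a y =>
    le_elements_hom.2 (le_iSup₂
      (f := fun (Y : Q) (y : M.obj Y) => M.map (Φ.elt (B := M.elements) (Y := Y) y a) y) Y y)
  have hΨ : ∀ {X Y : Q} (a : A.obj X) (y : M.obj Y),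
      Ψ.elt (A := M.elements) (X := Y) a y ≤ M.elements.hom (K a) y := by
    intro X Y a y
    rw [le_elements_hom, M.map_iSup]
    refine iSup_le fun Z => ?_
    rw [M.map_iSup]
    refine iSup_le fun z => ?_
    rw [← M.map_comp, ← le_elements_hom]
    exact (le_iSup₂ (f := fun (X : Q) (a : A.obj X) =>
      Ψ.elt (A := M.elements) (X := Y) a y ≫ Φ.elt (B := M.elements) (Y := Z) z a) X a).trans
        (h2 (Y' := Z) (Y := Y) z y)
  have hrep : ∀ {X Y : Q} (a : A.obj X) (y : M.obj Y),
      Φ.elt (B := M.elements) (Y := Y) y a = M.elements.hom y (K a) := by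
    intro X Y a y
    refine le_antisymm (hK a y) ?_
    calc M.elements.hom y (K a) = 𝟙 X ≫ M.elements.hom y (K a) := (Category.id_comp _).symm
      _ ≤ (⨆ (Z : Q) (z : M.obj Z), Φ.elt (B := M.elements) (Y := Z) z a ≫
            Ψ.elt (A := M.elements) (X := Z) a z) ≫ M.elements.hom y (K a) :=
          comp_le_comp ((A.id_le a).trans (h1 a a)) le_rfl
      _ ≤ Φ.elt (B := M.elements) (Y := Y) y a := by
          simp only [iSup_comp, Category.assoc]
          refine iSup₂_le fun Z z => ?_
          refine (comp_le_comp le_rfl ((comp_le_comp (hΨ a z) le_rfl).trans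
            (M.elements.comp_le y (K a) z))).trans ?_
          exact Φ.hom_left (Y := Y) (Y' := Z) y z a
  refine ⟨{ app := K, hom_le := fun {X' X} a' a => ?_ }, fun y a => hrep a y⟩
  rw [← hrep]
  calc A.hom a' a = A.hom a' a ≫ 𝟙 X' := (Category.comp_id _).symm
    _ ≤ A.hom a' a ≫ Φ.elt (B := M.elements) (Y := X') (K a') a' := by
        rw [hrep]
        exact comp_le_comp le_rfl (M.elements.id_le _)
    _ ≤ Φ.elt (B := M.elements) (Y := X') (K a') a := Φ.hom_right _ _ _

end QMod

/-- The forgetful 2-functor `U : Mod(Q) ⟶ Ord(Q)`, which sends a `Q`-module `M` to the `Q_si`-category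
of elements of `M_si`. -/
def forgetful (Q : Type u) [Category.{u} Q] [Quantaloid Q] :
    Pseudofunctor (QMod Q) (OrdSheaf Q) :=
  LocallyOrdered.twoFunctor
    { obj := fun M => ⟨M.si.elements, M.si.elements_isCauchyComplete⟩
      map := fun α => QMod.elementsMap (QMod.siMap α)
      map_id := fun _ => rfl
      map_comp := fun _ _ => rfl }
    (fun {M N α β} h {e} x => QMod.le_elements_hom.2
      ((N.si.map_id _).le.trans (h e.X x.1)))

end OrderedSheaves

end

open OrderedSheaves

noncomputable section

/-! All 2-cells here are inequalities, so coherence is automatic, and each claim reduces to data on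
objects and 1-cells plus inequalities.

The biadjunction is the universal property of presheaves. Every presheaf is the supremum of
representables tensored with its values (`iSup_map_yoneda`). A morphism out of the free module is
therefore determined, together with its order, by its effect on representables (`le_of_yoneda_le`),
and every functor into the elements of `M` extends along Yoneda (`extend_yoneda`).

For the biequivalence, call `x` in `M.Fix e` principal if the morphism from the fixpoint module of
`e` that it defines has a right adjoint. That adjoint must be `M.residual x`, so principality says
that this residual preserves suprema and the action of arrows. The inverse 2-functor sends `M` to
its category of principal elements, which is Cauchy complete for every `M`
(`principals_isCauchyComplete`); it acts on left adjoints because these compose.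

Two comparisons remain. Representables are principal, with evaluation as right adjoint, and on a
Cauchy complete `A` every principal presheaf is representable (`exists_inverse_yonedaPrincipals`):
since its residual preserves suprema, the principal presheaves assemble into a left adjoint
distributor into `A`. Conversely `M` maps to presheaves on its principal elements by `z ↦ M.residual
p z`, and back by suprema of tensors. One composite is always the identity; the other is the
identity exactly when every element is a supremum of tensors of principal elements, which is what
local principal generation provides. -/

namespace OrderedSheaves

/-! ## Pseudonatural equivalences between pseudofunctors into a locally ordered category -/

section Pointwise

open Bicategory
open scoped Pseudofunctor.StrongTrans

variable {B : Type u} [Bicategory.{w, v} B] {C : Type u'} [Bicategory.{w', v'} C]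

/-- If parallel 2-cells of the target are equal, a strong transformation is given by its components
and the naturality isomorphisms. -/
def strongTransOfSubsingleton (hC : ∀ {X Y : C} (f g : X ⟶ Y), Subsingleton (f ⟶ g))
    {F G : Pseudofunctor B C} (app : ∀ a, F.obj a ⟶ G.obj a)
    (nat : ∀ {a b : B} (f : a ⟶ b), F.map f ≫ app b ≅ app a ≫ G.map f) :
    Pseudofunctor.StrongTrans F G where
  app := app
  naturality := nat
  naturality_naturality _ := (hC _ _).elim _ _
  naturality_id _ := (hC _ _).elim _ _
  naturality_comp _ _ := (hC _ _).elim _ _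

/-- If parallel 2-cells of the target are equal, a pseudonatural family of equivalences is a
pseudonatural equivalence. -/
theorem nonempty_equivalence_of_pointwise (hC : ∀ {X Y : C} (f g : X ⟶ Y), Subsingleton (f ⟶ g))
    {F G : Pseudofunctor B C} (app : ∀ a, F.obj a ⟶ G.obj a)
    (nat : ∀ {a b : B} (f : a ⟶ b), F.map f ≫ app b ≅ app a ≫ G.map f)
    (inv : ∀ a, G.obj a ⟶ F.obj a) (unit : ∀ a, 𝟙 (F.obj a) ≅ app a ≫ inv a)
    (counit : ∀ a, inv a ≫ app a ≅ 𝟙 (G.obj a)) :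
    Nonempty (Bicategory.Equivalence F G) := by
  let η : F ⟶ G := strongTransOfSubsingleton hC app nat
  -- The naturality of the inverse is the mate of `nat`: insert the counit at the source, apply
  -- `nat` backwards, and cancel with the unit.
  let θ : G ⟶ F := strongTransOfSubsingleton hC inv fun {a b} f =>
    (λ_ _).symm ≪≫ whiskerRightIso (counit a).symm _ ≪≫ α_ _ _ _ ≪≫
      whiskerLeftIso (inv a) ((α_ _ _ _).symm ≪≫ whiskerRightIso (nat f).symm (inv b) ≪≫
        α_ _ _ _ ≪≫ whiskerLeftIso (F.map f) (unit b).symm ≪≫ ρ_ _)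
  have hsub : ∀ {X Y : Pseudofunctor B C} (f g : X ⟶ Y) (s t : f ⟶ g), s = t := fun f g s t =>
    Pseudofunctor.StrongTrans.homCategory.ext fun b => (hC _ _).elim _ _
  exact ⟨{
    hom := η
    inv := θ
    unit := Pseudofunctor.StrongTrans.isoMk unit fun _ => (hC _ _).elim _ _
    counit := Pseudofunctor.StrongTrans.isoMk counit fun _ => (hC _ _).elim _ _
    left_triangle := Iso.ext (hsub _ _ _ _) }⟩

end Pointwise

theorem LocallyOrdered.subsingleton_hom₂ {C : Type u} [Category.{v} C] [LocallyOrdered C]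
    {X Y : C} (f g : X ⟶ Y) :
    letI := LocallyOrdered.toBicategory C
    Subsingleton (f ⟶ g) :=
  inferInstanceAs (Subsingleton (ULift (PLift (f ≤ g))))

/-- In a locally ordered category, 2-cells in both directions form an isomorphism. -/
def LocallyOrdered.isoOfLE {C : Type u} [Category.{v} C] [LocallyOrdered C]
    {X Y : C} {f g : X ⟶ Y} (h : f ≤ g) (h' : g ≤ f) :
    letI := LocallyOrdered.toBicategory C
    f ≅ g :=
  letI := LocallyOrdered.toBicategory C
  { hom := homOfLE h
    inv := homOfLE h' }

/-! ## Locally principal elements -/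

section Principal

variable {Q : Type u} [Category.{u} Q] [Quantaloid Q]

namespace QMod

/-- The largest arrow `f` from `X` to the type of `p` with `M(f)(p) ≤ z`. -/
def residual (M : QMod Q) {e : Karoubi Q} (p : M.Fix e) {X : Q} (z : M.obj X) :
    (toKaroubi Q).obj X ⟶ e :=
  sSup {f | M.map f.f p.1 ≤ z}

/-- Suprema in the completion are computed on underlying arrows, and the action of `M` preserves
them, so the defining supremum is itself a solution. -/
theorem le_residual {M : QMod Q} {e : Karoubi Q} {p : M.Fix e} {X : Q} {z : M.obj X}
    {f : (toKaroubi Q).obj X ⟶ e} : f ≤ M.residual p z ↔ M.map f.f p.1 ≤ z := by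
  constructor
  · intro h
    refine (M.map_mono (f := f.f) (g := (M.residual p z).f) h le_rfl).trans ?_
    rw [residual, karoubi_sSup_f, M.iSup_map]
    refine iSup_le fun g => ?_
    rw [M.iSup_map]
    exact iSup_le fun hg => hg
  · intro h
    exact le_sSup h

theorem map_residual_le (M : QMod Q) {e : Karoubi Q} (p : M.Fix e) {X : Q} (z : M.obj X) :
    M.map (M.residual p z).f p.1 ≤ z :=
  le_residual.1 le_rfl

/-- The element `x` with `M(e)(x) = x` is principal at `e` if `τ_x ∘ σ_e` is a left adjoint. -/
def IsPrincipal (M : QMod Q) {e : Karoubi Q} (x : M.Fix e) : Prop :=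
  IsMap (sigma e ≫ M.tau x.1)

theorem isPrincipal_of_adjoint {M : QMod Q} {e : Karoubi Q} {x : M.Fix e} (r : M ⟶ fixpoint e)
    (h : ∀ {X : Q} (f : (toKaroubi Q).obj X ⟶ e), f ≤ r.app X (M.map f.f x.1))
    (h' : ∀ {X : Q} (z : M.obj X), M.map (Karoubi.Hom.f (r.app X z)) x.1 ≤ z) :
    M.IsPrincipal x :=
  ⟨r, fun _ f => h f, fun _ z => h' z⟩

/-- Right adjoints are unique: any adjoint satisfies the universal property of the residual
pointwise. The residual thereby inherits naturality and preservation of suprema, which fail for a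
general element. -/
theorem IsPrincipal.exists_adjoint_eq_residual {M : QMod Q} {e : Karoubi Q} {p : M.Fix e}
    (hp : M.IsPrincipal p) :
    ∃ r : M ⟶ fixpoint e, ∀ {X : Q} (z : M.obj X), r.app X z = M.residual p z := by
  obtain ⟨r, h1, h2⟩ := hp
  refine ⟨r, fun {X} z => le_antisymm (le_residual.2 (h2 X z)) ?_⟩
  exact (h1 X (M.residual p z)).trans (r.mono (M.map_residual_le p z))

/-- The right adjoint of `τ_p ∘ σ_e`, for a principal element `p`. -/
def IsPrincipal.residualHom {M : QMod Q} {e : Karoubi Q} {p : M.Fix e} (hp : M.IsPrincipal p) :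
    M ⟶ fixpoint e where
  app _ z := M.residual p z
  map_sSup _ S := by
    obtain ⟨r, hr⟩ := hp.exists_adjoint_eq_residual
    simp only [← hr]
    exact r.map_sSup _ S
  naturality f z := by
    obtain ⟨r, hr⟩ := hp.exists_adjoint_eq_residual
    simp only [← hr]
    exact r.naturality f z

theorem IsPrincipal.residual_map {M : QMod Q} {e : Karoubi Q} {p : M.Fix e}
    (hp : M.IsPrincipal p) {X Y : Q} (f : X ⟶ Y) (z : M.obj Y) :
    M.residual p (M.map f z) = (toKaroubi Q).map f ≫ M.residual p z :=
  hp.residualHom.naturality f z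

theorem IsPrincipal.residual_iSup {M : QMod Q} {e : Karoubi Q} {p : M.Fix e}
    (hp : M.IsPrincipal p) {ι : Sort*} {X : Q} (z : ι → M.obj X) :
    M.residual p (⨆ i, z i) = ⨆ i, M.residual p (z i) :=
  hp.residualHom.map_iSup z

/-- Postcomposition with `g`, as a morphism of fixpoint modules. -/
def fixpointMap {d e : Karoubi Q} (g : d ⟶ e) : fixpoint d ⟶ fixpoint e where
  app X f := CategoryStruct.comp (X := (toKaroubi Q).obj X) f g
  map_sSup _ S := Quantaloid.sSup_comp S g
  naturality _ _ := Category.assoc _ _ _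

/-- Residuals take values at types from `Q` only. The type `d` is a retract of `d.X`, so homs out of
`d` are recovered by restricting along the section. -/
theorem elements_si_hom (M : QMod Q) {d e : Karoubi Q} (y : M.Fix e) (x : M.Fix d) :
    M.si.elements.hom y x = d.decompId_i ≫ M.residual y x.1 := by
  apply le_antisymm
  · have h : d.decompId_p ≫ M.si.elements.hom y x ≤ M.residual y x.1 := by
      rw [le_residual]
      have h1 : M.map (M.si.elements.hom y x).f y.1 ≤ x.1 :=
        le_elements_hom (M := M.si) (y := y) (x := x) |>.1 le_rfl
      rw [Karoubi.comp_f, M.map_comp]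
      exact (M.map_mono le_rfl h1).trans x.2.le
    calc M.si.elements.hom y x = d.decompId_i ≫ d.decompId_p ≫ M.si.elements.hom y x := by
          rw [← Category.assoc, ← Karoubi.decompId, Category.id_comp]
      _ ≤ _ := comp_le_comp le_rfl h
  · refine le_elements_hom (M := M.si) (y := y) (x := x) |>.2 ?_
    change M.map (d.decompId_i ≫ M.residual y x.1).f y.1 ≤ x.1
    rw [Karoubi.comp_f, M.map_comp]
    exact (M.map_mono le_rfl (M.map_residual_le y x.1)).trans x.2.le

/-- The full subcategory of the category of elements of `M_si` on the principal elements. -/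
def principals (M : QMod Q) : QCat (Karoubi Q) where
  obj e := {x : M.Fix e // M.IsPrincipal x}
  hom y x := M.si.elements.hom y.1 x.1
  comp_le z y x := M.si.elements.comp_le z.1 y.1 x.1
  id_le x := M.si.elements.id_le x.1

theorem le_principals_hom {M : QMod Q} {d e : Karoubi Q} {y : M.principals.obj e}
    {x : M.principals.obj d} {f : d ⟶ e} :
    f ≤ M.principals.hom y x ↔ M.map f.f y.1.1 ≤ x.1.1 :=
  le_elements_hom (M := M.si) (y := y.1) (x := x.1)

theorem map_principals_hom_le (M : QMod Q) {d e : Karoubi Q} (y : M.principals.obj e)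
    (x : M.principals.obj d) : M.map (M.principals.hom y x).f y.1.1 ≤ x.1.1 :=
  le_principals_hom.1 le_rfl

/-- Given `Φ ⊣ Ψ`, the representing object at `a` is the supremum in `M` of the elements `p`
weighted by `Φ(p, a)`. It is again principal because `Ψ` supplies a right adjoint. -/
theorem principals_isCauchyComplete (M : QMod Q) : M.principals.IsCauchyComplete := by
  intro A Φ ⟨Ψ, h1, h2⟩
  let K₀ : ∀ {d : Karoubi Q}, A.obj d → M.Fix d := fun {d} a =>
    ⨆ (e : Karoubi Q) (p : M.principals.obj e), M.si.map (Φ.elt p a) p.1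
  have hK₀ : ∀ {d : Karoubi Q} (a : A.obj d), (K₀ a).1 =
      ⨆ (e : Karoubi Q) (p : M.principals.obj e), M.map (Φ.elt p a).f p.1.1 := fun a => by
    refine (Fix.iSup_val (M := M) _).trans (iSup_congr fun e => ?_)
    exact Fix.iSup_val (M := M) _
  have hΦ : ∀ {d e : Karoubi Q} (a : A.obj d) (p : M.principals.obj e),
      M.map (Φ.elt p a).f p.1.1 ≤ (K₀ a).1 := fun {d e} a p => by
    rw [hK₀]
    exact le_iSup₂ (f := fun (e : Karoubi Q) (p : M.principals.obj e) =>
      M.map (Φ.elt p a).f p.1.1) e p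
  have hΨ : ∀ {d e : Karoubi Q} (a : A.obj d) (p : M.principals.obj e),
      M.map (Ψ.elt a p).f (K₀ a).1 ≤ p.1.1 := fun {d e} a p => by
    rw [hK₀, M.map_iSup]
    refine iSup_le fun c => ?_
    rw [M.map_iSup]
    refine iSup_le fun q => ?_
    rw [← M.map_comp]
    refine le_principals_hom (f := Ψ.elt a p ≫ Φ.elt q a).1 (le_trans ?_ (h2 q p))
    exact le_iSup₂ (f := fun (d : Karoubi Q) (a : A.obj d) => Ψ.elt a p ≫ Φ.elt q a) d a
  have hprin : ∀ {d : Karoubi Q} (a : A.obj d), M.IsPrincipal (K₀ a) := fun {d} a => by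
    -- If `K₀ a` were the `Φ`-weighted supremum with `Ψ(a, p) = [K₀ a, p]`, mapping out of it would
    -- factor through the principal `p`; this is the resulting candidate for the right adjoint.
    let r : M ⟶ fixpoint d := ⨆ (e : Karoubi Q) (p : M.principals.obj e),
      p.2.residualHom ≫ fixpointMap (Ψ.elt a p)
    have hr : ∀ {X : Q} (z : M.obj X), r.app X z =
        ⨆ (e : Karoubi Q) (p : M.principals.obj e),
          M.residual p.1 z ≫ Ψ.elt a p := fun {X} z => by
      refine (iSup_app _ X z).trans (iSup_congr fun e => ?_)
      exact iSup_app (fun p : M.principals.obj e => p.2.residualHom ≫ fixpointMap (Ψ.elt a p)) X z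
    refine isPrincipal_of_adjoint r (fun {X} f => ?_) (fun {X} z => ?_)
    · rw [hr]
      -- The unit of `r` comes from the unit `A ≤ Ψ ⊗ Φ` at `a`.
      calc f = f ≫ 𝟙 d := (Category.comp_id f).symm
        _ ≤ f ≫ Ψ.compElt Φ a a := comp_le_comp le_rfl ((A.id_le a).trans (h1 a a))
        _ ≤ _ := ?_
      simp only [QCat.Distributor.compElt, comp_iSup]
      refine iSup₂_mono fun e p => ?_
      rw [← Category.assoc]
      refine comp_le_comp (le_residual.2 ?_) le_rfl
      rw [Karoubi.comp_f, M.map_comp]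
      exact M.map_mono le_rfl (hΦ a p)
    · rw [hr, karoubi_iSup_f, M.iSup_map]
      refine iSup_le fun e => ?_
      rw [karoubi_iSup_f, M.iSup_map]
      refine iSup_le fun p => ?_
      rw [Karoubi.comp_f, M.map_comp]
      exact (M.map_mono le_rfl (hΨ a p)).trans (M.map_residual_le p.1 z)
  let K : ∀ {d : Karoubi Q}, A.obj d → M.principals.obj d := fun a => ⟨K₀ a, hprin a⟩
  have hrep : ∀ {d e : Karoubi Q} (a : A.obj d) (p : M.principals.obj e),
      Φ.elt p a = M.principals.hom p (K a) := by
    intro d e a p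
    refine le_antisymm (le_principals_hom.2 (hΦ a p)) ?_
    -- Insert the unit of `Φ ⊣ Ψ`; `Ψ(a, q)` lies below `hom (K a) q`, and the remaining composite
    -- is absorbed by `Φ`.
    calc M.principals.hom p (K a) = 𝟙 d ≫ M.principals.hom p (K a) := (Category.id_comp _).symm
      _ ≤ Ψ.compElt Φ a a ≫ M.principals.hom p (K a) :=
          comp_le_comp ((A.id_le a).trans (h1 a a)) le_rfl
      _ ≤ Φ.elt p a := by
          simp only [QCat.Distributor.compElt, iSup_comp, Category.assoc]
          refine iSup₂_le fun c q => ?_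
          refine (comp_le_comp le_rfl ((comp_le_comp (le_principals_hom.2 (hΨ a q)) le_rfl).trans
            (M.principals.comp_le p (K a) q))).trans ?_
          exact Φ.hom_left p q a
  refine ⟨{ app := K, hom_le := fun {d' d} a' a => ?_ }, fun p a => hrep a p⟩
  rw [← hrep]
  calc A.hom a' a = A.hom a' a ≫ 𝟙 d' := (Category.comp_id _).symm
    _ ≤ A.hom a' a ≫ Φ.elt (K a') a' := by
        rw [hrep]
        exact comp_le_comp le_rfl (M.principals.id_le _)
    _ ≤ Φ.elt (K a') a := Φ.hom_right _ _ _

end QMod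

end Principal

/-! ## Free cocompletions are locally principally generated -/

section Yoneda

variable {Q : Type u} [Category.{u} Q] [Quantaloid Q]

namespace QCat

/-- The module on `Q` of presheaves on a category `A` enriched in the completion of `Q`. -/
abbrev freeModule (A : QCat (Karoubi Q)) : QMod Q :=
  QMod.restrict.obj (presheafMod A)

/-- The representable presheaf `A(-, a)`, as an element of the free cocompletion that is fixed by the
type of `a`. -/
def yoneda (A : QCat (Karoubi Q)) {e : Karoubi Q} (a : A.obj e) : A.freeModule.Fix e where
  val :=
    -- The free module has only types from `Q`; precomposing with the retraction moves `A(-, a)`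
    -- from type `e` to type `e.X`.
    { elt := fun b => e.decompId_p ≫ A.hom b a
      hom_left := fun b b' => by
        rw [Category.assoc]
        exact comp_le_comp le_rfl (A.comp_le b b' a) }
  property := Presheaf.ext (funext fun d => funext fun b => by
    change (toKaroubi Q).map e.p ≫ e.decompId_p ≫ A.hom b a = e.decompId_p ≫ A.hom b a
    rw [← Category.assoc]
    congr 1
    apply Karoubi.hom_ext
    simp)

/-- A presheaf is the supremum of the representables it is tensored from. -/
theorem iSup_map_yoneda (A : QCat (Karoubi Q)) {X : Q} (φ : A.freeModule.obj X) :
    (⨆ (e : Karoubi Q) (a : A.obj e),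
      A.freeModule.map (Presheaf.elt φ a).f (A.yoneda a).1) = φ := by
  refine Presheaf.ext (funext fun d => funext fun b => ?_)
  refine (Presheaf.iSup_elt (A := A) _ b).trans ?_
  refine (iSup_congr fun e => Presheaf.iSup_elt (A := A) _ b).trans ?_
  refine Eq.trans (iSup_congr fun e => iSup_congr fun a => ?_) (Presheaf.iSup_hom φ b)
  change (toKaroubi Q).map (Presheaf.elt φ a).f ≫ e.decompId_p ≫ A.hom b a = _
  rw [← Category.assoc]
  congr 1
  apply Karoubi.hom_ext
  simp

theorem map_yoneda_le_iff (A : QCat (Karoubi Q)) {X : Q} {e : Karoubi Q} (a : A.obj e)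
    (f : (toKaroubi Q).obj X ⟶ e) (φ : A.freeModule.obj X) :
    A.freeModule.map f.f (A.yoneda a).1 ≤ φ ↔ f ≤ Presheaf.elt φ a := by
  have hf : (toKaroubi Q).map f.f ≫ e.decompId_p = f := by
    apply Karoubi.hom_ext
    simp
  constructor
  · intro h
    have h1 : (toKaroubi Q).map f.f ≫ e.decompId_p ≫ A.hom a a ≤ Presheaf.elt φ a := h e a
    rw [← Category.assoc, hf] at h1
    refine le_trans ?_ h1
    calc f = f ≫ 𝟙 e := (Category.comp_id f).symm
      _ ≤ f ≫ A.hom a a := comp_le_comp le_rfl (A.id_le a)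
  · intro h d b
    change (toKaroubi Q).map f.f ≫ e.decompId_p ≫ A.hom b a ≤ Presheaf.elt φ b
    rw [← Category.assoc, hf]
    exact (comp_le_comp h le_rfl).trans (Presheaf.hom_left φ b a)

/-- The Yoneda lemma. -/
theorem residual_yoneda (A : QCat (Karoubi Q)) {X : Q} {e : Karoubi Q} (a : A.obj e)
    (φ : A.freeModule.obj X) : A.freeModule.residual (A.yoneda a) φ = Presheaf.elt φ a :=
  eq_of_forall_le_iff fun f => by rw [QMod.le_residual, map_yoneda_le_iff]

/-- The right adjoint is evaluation at `a`, by the Yoneda lemma. -/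
theorem isPrincipal_yoneda (A : QCat (Karoubi Q)) {e : Karoubi Q} (a : A.obj e) :
    A.freeModule.IsPrincipal (A.yoneda a) :=
  QMod.isPrincipal_of_adjoint
    { app := fun _ φ => Presheaf.elt φ a
      map_sSup := fun _ S => Presheaf.sSup_elt (A := A) S a
      naturality := fun _ _ => rfl }
    (fun f => (A.map_yoneda_le_iff a f _).1 le_rfl)
    (fun φ => (A.map_yoneda_le_iff a _ φ).2 le_rfl)

theorem elements_hom_yoneda (A : QCat (Karoubi Q)) {d e : Karoubi Q} (a : A.obj e)
    (x : A.freeModule.Fix d) :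
    A.freeModule.si.elements.hom (A.yoneda a) x = d.decompId_i ≫ Presheaf.elt x.1 a := by
  rw [QMod.elements_si_hom, residual_yoneda]

theorem elements_hom_yoneda_yoneda (A : QCat (Karoubi Q)) {d e : Karoubi Q} (a : A.obj e)
    (b : A.obj d) :
    A.freeModule.si.elements.hom (A.yoneda a) (A.yoneda b) = A.hom a b := by
  rw [elements_hom_yoneda]
  change d.decompId_i ≫ d.decompId_p ≫ A.hom a b = A.hom a b
  rw [← Category.assoc, ← Karoubi.decompId, Category.id_comp]

/-- The supremum over `a'` is attained at `a' = a`: functoriality bounds every term, and the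
identity inequality of `A` gives the converse. -/
theorem presheafMap_yoneda {A B : QCat (Karoubi Q)} (F : A ⟶ B) {e : Karoubi Q} (a : A.obj e) :
    (QMod.restrict.map (presheafMap F)).app e.X (A.yoneda a).1 = (B.yoneda (F.app a)).1 := by
  refine Presheaf.ext (funext fun d => funext fun b => ?_)
  change (⨆ (Z : Karoubi Q) (a' : A.obj Z), (e.decompId_p ≫ A.hom a' a) ≫ B.hom b (F.app a')) =
    e.decompId_p ≫ B.hom b (F.app a)
  apply le_antisymm
  · refine iSup₂_le fun Z a' => ?_
    rw [Category.assoc]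
    exact comp_le_comp le_rfl ((comp_le_comp (F.hom_le a' a) le_rfl).trans (B.comp_le _ _ _))
  · refine le_iSup₂_of_le e a ?_
    rw [Category.assoc]
    refine comp_le_comp le_rfl ?_
    calc B.hom b (F.app a) = 𝟙 e ≫ B.hom b (F.app a) := (Category.id_comp _).symm
      _ ≤ A.hom a a ≫ B.hom b (F.app a) := comp_le_comp (A.id_le a) le_rfl

end QCat

/-! ### Local principal generation in terms of elements -/

namespace QMod

theorem IsPrincipal.isLocallyPrincipal {M : QMod Q} {e : Karoubi Q} {p : M.Fix e}
    (hp : M.IsPrincipal p) : M.IsLocallyPrincipal p.1 :=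
  ⟨e.p, e.idem, p.2, hp⟩

theorem tau_le_iff {M : QMod Q} {X : Q} {x : M.obj X} {t : representable X ⟶ M} :
    M.tau x ≤ t ↔ x ≤ t.app X (𝟙 X : X ⟶ X) := by
  constructor
  · intro h
    exact (M.map_id x).ge.trans (h X (𝟙 X : X ⟶ X))
  · intro h Y (f : Y ⟶ X)
    calc M.map f x ≤ M.map f (t.app X (𝟙 X : X ⟶ X)) := M.map_mono le_rfl h
      _ = t.app Y (f ≫ 𝟙 X : Y ⟶ X) := (t.naturality f _).symm
      _ = t.app Y f := by rw [Category.comp_id]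

theorem lifting_comp_le {K : Type u'} [Category.{v'} K] [Quantaloid K] {X Y A : K}
    (f : X ⟶ Y) (g : A ⟶ Y) : lifting f g ≫ f ≤ g := by
  rw [lifting, Quantaloid.sSup_comp]
  exact iSup₂_le fun h hh => hh

/-- A module is locally principally generated if every element is a supremum of tensors of
principal elements. -/
theorem isLocallyPrincipallyGenerated_of_le_iSup {M : QMod Q}
    (h : ∀ {X : Q} (x : M.obj X), x ≤ ⨆ (e : Karoubi Q) (p : M.principals.obj e),
      M.map (M.residual p.1 x).f p.1.1) : M.IsLocallyPrincipallyGenerated := by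
  intro X x
  apply le_antisymm
  · refine tau_le_iff.2 ((h x).trans (iSup₂_le fun e p => ?_))
    let g : X ⟶ e.X := (M.residual p.1 x).f
    -- The residual, read as a morphism of representables, competes in the supremum defining the
    -- lifting; everything is then tested at the identity of `X`.
    have h1 : (representable e.X).tau g ≤ lifting (M.tau p.1.1) (M.tau x) := le_sSup (by
      intro Y (f : Y ⟶ X)
      change M.map (f ≫ g) p.1.1 ≤ M.map f x
      rw [M.map_comp]
      exact M.map_mono le_rfl (M.map_residual_le p.1 x))
    have h2 : M.map g p.1.1 ≤ ((representable e.X).tau g ≫ M.tau p.1.1).app X (𝟙 X : X ⟶ X) :=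
      (congrArg (fun f => M.map f p.1.1) (Category.id_comp g)).ge
    refine h2.trans (LE.le.trans (b := lifting (M.tau p.1.1) (M.tau x) ≫ M.tau p.1.1)
      (comp_le_comp h1 le_rfl) (le_sSup ?_) X (𝟙 X : X ⟶ X))
    exact ⟨e.X, p.1.1, p.2.isLocallyPrincipal, rfl⟩
  · refine sSup_le ?_
    rintro _ ⟨A, a, -, rfl⟩
    exact lifting_comp_le _ _

/-- By Yoneda the equation for `τ_x` is evaluated at the identity; the lifting there is an arrow `g`
with `M(g)(a) ≤ x`. -/
theorem IsLocallyPrincipallyGenerated.le_iSup {M : QMod Q}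
    (h : M.IsLocallyPrincipallyGenerated) {X : Q} (x : M.obj X) :
    x ≤ ⨆ (e : Karoubi Q) (p : M.principals.obj e), M.map (M.residual p.1 x).f p.1.1 := by
  refine (tau_le_iff.1 (h x).le).trans ?_
  refine (sSup_app (M := representable X) _ X (𝟙 X : X ⟶ X)).le.trans (iSup₂_le ?_)
  rintro _ ⟨A, a, ⟨e, he, ha, hp⟩, rfl⟩
  let g : X ⟶ A := (lifting (M.tau a) (M.tau x)).app X (𝟙 X : X ⟶ X)
  have hg : M.map g a ≤ x :=
    (lifting_comp_le (M.tau a) (M.tau x) X (𝟙 X : X ⟶ X)).trans (M.map_id x).le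
  -- Composing with `e` turns `g` into an arrow of the completion with target `e`, and does not
  -- change the tensor because `M(e)(a) = a`.
  let f : (toKaroubi Q).obj X ⟶ ⟨A, e, he⟩ := ⟨g ≫ e, by simp [he]⟩
  let p : M.principals.obj ⟨A, e, he⟩ := ⟨⟨a, ha⟩, hp⟩
  have hf : M.map f.f a = M.map g a := (M.map_comp g e a).trans (congrArg _ ha)
  refine le_iSup₂_of_le ⟨A, e, he⟩ p ?_
  change M.map g a ≤ _
  rw [← hf]
  exact M.map_mono (le_residual (p := p.1).2 (hf.le.trans hg)) le_rfl

end QMod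

namespace QCat

theorem freeModule_isLocallyPrincipallyGenerated (A : QCat (Karoubi Q)) :
    A.freeModule.IsLocallyPrincipallyGenerated := by
  refine QMod.isLocallyPrincipallyGenerated_of_le_iSup fun {X} φ => ?_
  refine (A.iSup_map_yoneda φ).ge.trans (iSup₂_le fun e a => ?_)
  refine le_iSup₂_of_le e (⟨A.yoneda a, A.isPrincipal_yoneda a⟩ : A.freeModule.principals.obj e) ?_
  exact (congrArg (fun f => A.freeModule.map (Karoubi.Hom.f f) (A.yoneda a).1)
    (A.residual_yoneda a φ)).ge

/-- The right adjoint of `presheafMap F`, which restricts presheaves along `F`. -/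
def presheafRestrict {A B : QCat (Karoubi Q)} (F : A ⟶ B) : presheafMod B ⟶ presheafMod A where
  app X ψ :=
    { elt := fun a => Presheaf.elt ψ (F.app a)
      hom_left := fun a a' => (comp_le_comp le_rfl (F.hom_le a a')).trans (ψ.hom_left _ _) }
  map_sSup X S := by
    refine Presheaf.ext (funext fun Y => funext fun a => ?_)
    change (sSup S : Presheaf B X).elt (F.app a) = _
    refine Eq.trans ?_ (Presheaf.iSup_elt (A := A) (X := X) _ a).symm
    refine Eq.trans ?_ (iSup_congr fun ψ => (Presheaf.iSup_elt (A := A) (X := X) _ a).symm)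
    exact Presheaf.sSup_elt (A := B) (X := X) S (F.app a)
  naturality f ψ := rfl

theorem isMap_presheafMap {A B : QCat (Karoubi Q)} (F : A ⟶ B) :
    IsMap (QMod.restrict.map (presheafMap F)) := by
  refine ⟨QMod.restrict.map (presheafRestrict F), ?_, ?_⟩
  · intro X φ d a
    refine le_trans ?_ (le_iSup₂ (f := fun (e : Karoubi Q) (a' : A.obj e) =>
      Presheaf.elt φ a' ≫ B.hom (F.app a) (F.app a')) d a)
    calc Presheaf.elt φ a = Presheaf.elt φ a ≫ 𝟙 d := (Category.comp_id _).symm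
      _ ≤ _ := comp_le_comp le_rfl (B.id_le _)
  · intro X ψ d b
    exact iSup₂_le fun e a => Presheaf.hom_left ψ b (F.app a)

end QCat

end Yoneda

/-! ## The universal property of free cocompletions -/

section Biadjunction

variable {Q : Type u} [Category.{u} Q] [Quantaloid Q]

namespace QCat

/-- The Yoneda embedding. -/
def yonedaFunctor (A : QCat (Karoubi Q)) : A ⟶ A.freeModule.si.elements where
  app a := A.yoneda a
  hom_le a b := (A.elements_hom_yoneda_yoneda a b).ge

/-- The extension of a functor to the module of elements of `M` along the Yoneda embedding. -/
def extend {A : QCat (Karoubi Q)} {M : QMod Q} (G : A ⟶ M.si.elements) : A.freeModule ⟶ M where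
  app X φ := ⨆ (e : Karoubi Q) (a : A.obj e), M.map (Presheaf.elt φ a).f (Subtype.val (G.app a))
  map_sSup X S := by
    have h : ∀ {e : Karoubi Q} (a : A.obj e),
        M.map (Presheaf.elt (sSup S : A.freeModule.obj X) a).f (Subtype.val (G.app a)) =
          ⨆ φ ∈ S, M.map (Presheaf.elt φ a).f (Subtype.val (G.app a)) := fun {e} a => by
      refine (congrArg (fun f => M.map (Karoubi.Hom.f f) (Subtype.val (G.app a)))
        (Presheaf.sSup_elt (A := A) S a)).trans ?_
      simp only [karoubi_iSup_f, M.iSup_map]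
      rfl
    simp only [h]
    apply le_antisymm
    · exact iSup₂_le fun e a => iSup₂_le fun φ hφ => le_iSup₂_of_le φ hφ
        (le_iSup₂ (f := fun (e : Karoubi Q) (a : A.obj e) =>
          M.map (Presheaf.elt φ a).f (Subtype.val (G.app a))) e a)
    · exact iSup₂_le fun φ hφ => iSup₂_le fun e a => le_iSup₂_of_le e a
        (le_iSup₂ (f := fun (φ : A.freeModule.obj X) (_ : φ ∈ S) =>
          M.map (Presheaf.elt φ a).f (Subtype.val (G.app a))) φ hφ)
  naturality f φ := by
    simp only [M.map_iSup, ← M.map_comp]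
    rfl

theorem extend_app {A : QCat (Karoubi Q)} {M : QMod Q} (G : A ⟶ M.si.elements) {X : Q}
    (φ : A.freeModule.obj X) : (extend G).app X φ =
      ⨆ (e : Karoubi Q) (a : A.obj e), M.map (Presheaf.elt φ a).f (Subtype.val (G.app a)) :=
  rfl

/-- Every term is bounded by functoriality of `G`, and the term at `a` reaches the bound because `G
a` is fixed by `e`. -/
theorem extend_yoneda {A : QCat (Karoubi Q)} {M : QMod Q} (G : A ⟶ M.si.elements)
    {e : Karoubi Q} (a : A.obj e) :
    (extend G).app e.X (A.yoneda a).1 = Subtype.val (G.app a) := by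
  have hf : ∀ {d : Karoubi Q} (b : A.obj d),
      (Presheaf.elt (A.yoneda a).1 b).f = (A.hom b a).f := fun b => by
    change (e.decompId_p ≫ A.hom b a).f = _
    simp
  rw [extend_app]
  apply le_antisymm
  · refine iSup₂_le fun d b => ?_
    rw [hf]
    exact QMod.le_elements_hom (M := M.si) (y := G.app b) (x := G.app a) |>.1 (G.hom_le b a)
  · refine le_iSup₂_of_le e a ?_
    rw [hf]
    exact (G.app a).2.ge.trans (M.map_mono (f := e.p) (A.id_le a) le_rfl)

/-- Module morphisms on a free cocompletion are compared on representables. -/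
theorem le_of_yoneda_le {A : QCat (Karoubi Q)} {M : QMod Q} {α β : A.freeModule ⟶ M}
    (h : ∀ {e : Karoubi Q} (a : A.obj e),
      α.app e.X (A.yoneda a).1 ≤ β.app e.X (A.yoneda a).1) : α ≤ β := by
  intro X φ
  change α.app X φ ≤ β.app X φ
  rw [← A.iSup_map_yoneda φ]
  simp only [QMod.Hom.map_iSup, QMod.Hom.naturality]
  exact iSup₂_mono fun e a => M.map_mono le_rfl (h a)

theorem hom_ext_yoneda {A : QCat (Karoubi Q)} {M : QMod Q} {α β : A.freeModule ⟶ M}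
    (h : ∀ {e : Karoubi Q} (a : A.obj e),
      α.app e.X (A.yoneda a).1 = β.app e.X (A.yoneda a).1) : α = β :=
  le_antisymm (le_of_yoneda_le fun a => (h a).le) (le_of_yoneda_le fun a => (h a).ge)

theorem yonedaFunctor_naturality {A B : QCat (Karoubi Q)} (F : A ⟶ B) :
    F ≫ B.yonedaFunctor = A.yonedaFunctor ≫
      QMod.elementsMap (QMod.siMap (QMod.restrict.map (presheafMap F))) :=
  QCat.Hom.ext (funext fun _ => funext fun a => Subtype.ext (presheafMap_yoneda F a).symm)

end QCat

theorem QMod.hom_elements_si_le_iff {A : QCat (Karoubi Q)} {M : QMod Q}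
    {F G : A ⟶ M.si.elements} : F ≤ G ↔
      ∀ {e : Karoubi Q} (a : A.obj e), Subtype.val (F.app a) ≤ Subtype.val (G.app a) := by
  refine forall_congr' fun e => forall_congr' fun a => ?_
  refine (QMod.le_elements_hom (M := M.si) (y := F.app a) (x := G.app a)).trans ?_
  exact ⟨(M.si.map_id (F.app a)).ge.trans, (M.si.map_id (F.app a)).le.trans⟩

theorem isLeftBiadjoint_freeCocompletion_forgetful :
    IsLeftBiadjoint (freeCocompletion Q) (forgetful Q) := by
  refine ⟨strongTransOfSubsingleton LocallyOrdered.subsingleton_hom₂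
    (fun A => A.cat.yonedaFunctor)
    (fun F => eqToIso (QCat.yonedaFunctor_naturality F)), fun A M => ?_⟩
  -- The hom-categories are preorders: faithfulness is free, fullness is order reflection on
  -- representables, and essential surjectivity is extension along Yoneda.
  refine @Functor.IsEquivalence.mk _ _ _ _ _ ⟨?_⟩ ⟨?_⟩ ⟨?_⟩
  · intro α β s t _
    exact (LocallyOrdered.subsingleton_hom₂ α β).elim s t
  · intro α β s
    refine ⟨homOfLE (QCat.le_of_yoneda_le fun a => ?_),
      (LocallyOrdered.subsingleton_hom₂ (C := OrdSheaf Q) _ _).elim _ _⟩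
    exact QMod.hom_elements_si_le_iff.1 (leOfHom s) a
  · intro G
    refine ⟨QCat.extend G, ⟨eqToIso ?_⟩⟩
    exact QCat.Hom.ext (funext fun _ => funext fun a => Subtype.ext (QCat.extend_yoneda G a))

end Biadjunction

/-! ## The biequivalence with locally principally generated modules -/

section Biequivalence

variable {Q : Type u} [Category.{u} Q] [Quantaloid Q]

/-! ### Recovering a module from its principal elements -/

namespace QMod

/-- The inclusion of the principal elements into the category of elements of `M_si`. -/
def principalsInclusion (M : QMod Q) : M.principals ⟶ M.si.elements where
  app x := x.1
  hom_le _ _ := le_rfl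

theorem IsPrincipal.map {M N : QMod Q} {α : M ⟶ N} (hα : IsMap α) {e : Karoubi Q} {x : M.Fix e}
    (hx : M.IsPrincipal x) : N.IsPrincipal ((siMap α).app e x) := by
  have h : sigma e ≫ N.tau ((siMap α).app e x).1 = (sigma e ≫ M.tau x.1) ≫ α :=
    hom_ext fun X f => (α.naturality (Karoubi.Hom.f f) x.1).symm
  have h' : IsMap ((sigma e ≫ M.tau x.1) ≫ α) := IsMap.comp hx hα
  rwa [← h] at h'

/-- Left adjoint module morphisms preserve principal elements. -/
def principalsMap {M N : QMod Q} (α : M ⟶ N) (hα : IsMap α) : M.principals ⟶ N.principals where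
  app x := ⟨(siMap α).app _ x.1, x.2.map hα⟩
  hom_le y x := (elementsMap (siMap α)).hom_le y.1 x.1

/-- The canonical morphism from the free cocompletion of the principal elements of `M` to `M`. -/
def principalsCounit (M : QMod Q) : M.principals.freeModule ⟶ M :=
  QCat.extend M.principalsInclusion

theorem principalsCounit_naturality {M N : QMod Q} (α : M ⟶ N) (hα : IsMap α) :
    restrict.map (QCat.presheafMap (principalsMap α hα)) ≫ N.principalsCounit =
      M.principalsCounit ≫ α := by
  refine QCat.hom_ext_yoneda fun {e} a => ?_
  refine (congrArg (N.principalsCounit.app e.X)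
    (QCat.presheafMap_yoneda (principalsMap α hα) a)).trans ?_
  refine (QCat.extend_yoneda N.principalsInclusion _).trans ?_
  exact (congrArg (α.app e.X) (QCat.extend_yoneda M.principalsInclusion a)).symm

/-- Retraction followed by section is the idempotent `e`. Principality lets it pass inside the
residual, where it fixes `x`. -/
theorem IsPrincipal.decompId_p_comp_hom {M : QMod Q} {d e : Karoubi Q} {p : M.Fix d}
    (hp : M.IsPrincipal p) (x : M.Fix e) :
    e.decompId_p ≫ M.si.elements.hom p x = M.residual p x.1 := by
  rw [elements_si_hom, ← Category.assoc, ← Karoubi.decomp_p, ← hp.residual_map, x.2]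

/-- The canonical morphism from `M` to the free cocompletion of its principal elements. -/
def principalsNerve (M : QMod Q) : M ⟶ M.principals.freeModule where
  app X z :=
    { elt := fun p => M.residual p.1 z
      hom_left := fun p q => le_residual.2 (by
        rw [Karoubi.comp_f, M.map_comp]
        exact (M.map_mono le_rfl (M.map_principals_hom_le p q)).trans (M.map_residual_le q.1 z)) }
  map_sSup X S := by
    refine QCat.Presheaf.ext (funext fun e => funext fun p => ?_)
    refine Eq.trans ?_ (QCat.Presheaf.iSup_elt (A := M.principals) _ p).symm
    refine Eq.trans ?_ (iSup_congr fun z =>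
      (QCat.Presheaf.iSup_elt (A := M.principals) _ p).symm)
    exact p.2.residualHom.map_sSup X S
  naturality f z := QCat.Presheaf.ext (funext fun e => funext fun p => p.2.residual_map f z)

theorem principalsNerve_comp_counit {M : QMod Q} (hM : M.IsLocallyPrincipallyGenerated) :
    M.principalsNerve ≫ M.principalsCounit = 𝟙 M :=
  hom_ext fun _ z => le_antisymm (iSup₂_le fun _ p => M.map_residual_le p.1 z) (hM.le_iSup z)

/-- No generation hypothesis is needed: on a representable this is full faithfulness of the
inclusion of principal elements. -/
theorem principalsCounit_comp_nerve (M : QMod Q) :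
    M.principalsCounit ≫ M.principalsNerve = 𝟙 M.principals.freeModule := by
  refine QCat.hom_ext_yoneda fun {e} q => ?_
  refine (congrArg (M.principalsNerve.app e.X)
    (QCat.extend_yoneda M.principalsInclusion q)).trans ?_
  refine QCat.Presheaf.ext (funext fun d => funext fun p => ?_)
  exact (p.2.decompId_p_comp_hom q.1).symm

end QMod

theorem isMap_of_inverse {K : Type u'} [Category.{v'} K] [Quantaloid K] {X Y : K} {f : X ⟶ Y}
    {g : Y ⟶ X} (h : f ≫ g = 𝟙 X) (h' : g ≫ f = 𝟙 Y) : IsMap f :=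
  ⟨g, h.ge, h'.le⟩

/-! ### Principal presheaves on Cauchy complete categories -/

namespace QCat

theorem id_le_hom_of_yoneda_eq {A : QCat (Karoubi Q)} {e : Karoubi Q} {a b : A.obj e}
    (h : A.yoneda a = A.yoneda b) : 𝟙 e ≤ A.hom a b := by
  rw [← A.elements_hom_yoneda_yoneda, h, A.elements_hom_yoneda_yoneda]
  exact A.id_le b

/-- The Yoneda embedding into the category of principal presheaves. -/
def yonedaPrincipals (A : QCat (Karoubi Q)) : A ⟶ A.freeModule.principals where
  app a := ⟨A.yoneda a, A.isPrincipal_yoneda a⟩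
  hom_le a b := (A.elements_hom_yoneda_yoneda a b).ge

theorem yonedaPrincipals_naturality {A B : QCat (Karoubi Q)} (F : A ⟶ B) :
    F ≫ B.yonedaPrincipals = A.yonedaPrincipals ≫
      QMod.principalsMap (QMod.restrict.map (presheafMap F)) (isMap_presheafMap F) :=
  QCat.Hom.ext (funext fun _ => funext fun a =>
    Subtype.ext (Subtype.ext (presheafMap_yoneda F a).symm))

/-- Principal presheaves on a Cauchy complete category are representable. -/
theorem exists_inverse_yonedaPrincipals {A : QCat (Karoubi Q)} (hA : A.IsCauchyComplete) :
    ∃ R : A.freeModule.principals ⟶ A,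
      ∀ {e : Karoubi Q} (p : A.freeModule.principals.obj e), A.yoneda (R.app p) = p.1 := by
  let N := A.freeModule
  let y : ∀ {e : Karoubi Q}, A.obj e → N.principals.obj e := fun a => A.yonedaPrincipals.app a
  -- `Φ` and `Ψ` are the two distributors induced by the Yoneda embedding into principal presheaves;
  -- Cauchy completeness of `A` will represent `Φ`.
  let Φ : Distributor N.principals A :=
    { elt := fun a p => N.principals.hom (y a) p
      hom_left := fun a b p => by
        rw [← A.elements_hom_yoneda_yoneda a b]
        exact N.principals.comp_le (y a) (y b) p
      hom_right := fun a p q => N.principals.comp_le (y a) p q }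
  let Ψ : Distributor A N.principals :=
    { elt := fun p a => N.principals.hom p (y a)
      hom_left := fun p q a => N.principals.comp_le p q (y a)
      hom_right := fun p a b => by
        rw [← A.elements_hom_yoneda_yoneda a b]
        exact N.principals.comp_le p (y a) (y b) }
  have hΦ : ∀ {d e : Karoubi Q} (a : A.obj e) (p : N.principals.obj d),
      Φ.elt a p = d.decompId_i ≫ Presheaf.elt p.1.1 a := fun a p => A.elements_hom_yoneda a p.1
  have hΦΨ : Φ.IsCauchy := by
    refine ⟨Ψ, fun {e d} q p => ?_, fun {e d} a b => ?_⟩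
    · have h : N.residual q.1 p.1.1 =
          ⨆ (c : Karoubi Q) (a : A.obj c), Presheaf.elt p.1.1 a ≫ N.principals.hom q (y a) := by
        refine (congrArg (N.residual q.1) (A.iSup_map_yoneda p.1.1).symm).trans ?_
        rw [q.2.residual_iSup]
        refine iSup_congr fun c => ?_
        rw [q.2.residual_iSup]
        refine iSup_congr fun a => ?_
        rw [q.2.residual_map]
        refine Eq.trans ?_ (congrArg (Presheaf.elt p.1.1 a ≫ ·)
          (N.elements_si_hom q.1 (A.yoneda a)).symm)
        rw [← Category.assoc]
        congr 1
        apply Karoubi.hom_ext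
        simp
      refine (N.elements_si_hom q.1 p.1).le.trans ?_
      rw [h]
      simp only [comp_iSup, Distributor.compElt]
      refine iSup₂_mono fun c a => ?_
      rw [hΦ, Category.assoc]
    · refine iSup₂_le fun c p => ?_
      refine (N.principals.comp_le (y a) p (y b)).trans ?_
      exact (A.elements_hom_yoneda_yoneda a b).le
  obtain ⟨R, hR⟩ := hA N.principals Φ hΦΨ
  refine ⟨R, fun {e} p => Subtype.ext (Presheaf.ext (funext fun d => funext fun a => ?_))⟩
  -- `A(a, R p)` is `p(a)` precomposed with the section; adding the retraction leaves `e` acting on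
  -- `p`, which fixes it.
  change e.decompId_p ≫ A.hom a (R.app p) = _
  rw [← hR, hΦ, ← Category.assoc, ← Karoubi.decomp_p]
  exact congrArg (fun φ : A.freeModule.obj e.X => Presheaf.elt φ a) p.1.2

end QCat

/-- The 2-functor that sends a locally principally generated module to the ordered sheaf of its
principal elements. -/
def principalsFunctor (Q : Type u) [Category.{u} Q] [Quantaloid Q] :
    Pseudofunctor (MapModLpg Q) (OrdSheaf Q) :=
  LocallyOrdered.twoFunctor
    { obj := fun M => ⟨M.as.module.principals, M.as.module.principals_isCauchyComplete⟩
      map := fun α => QMod.principalsMap α.1 α.2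
      map_id := fun _ => rfl
      map_comp := fun _ _ => rfl }
    (fun {_ N _ _} h {e} x => QMod.le_elements_hom.2
      ((N.as.module.si.map_id _).le.trans (h e.X x.1.1)))

/-- The free-cocompletion 2-functor, with values in the locally principally generated modules and
left adjoint morphisms. -/
def freeCocompletionLpg (Q : Type u) [Category.{u} Q] [Quantaloid Q] :
    Pseudofunctor (OrdSheaf Q) (MapModLpg Q) :=
  LocallyOrdered.twoFunctor
    { obj := fun A => ⟨⟨A.cat.freeModule, A.cat.freeModule_isLocallyPrincipallyGenerated⟩⟩
      map := fun F => ⟨QMod.restrict.map (QCat.presheafMap F), QCat.isMap_presheafMap F⟩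
      map_id := fun A => Subtype.ext <| by
        refine Eq.trans ?_ (QMod.restrict.map_id _)
        exact congrArg QMod.restrict.map (QCat.presheafFunctor.map_id A.cat)
      map_comp := fun F G => Subtype.ext <| by
        refine Eq.trans ?_ (QMod.restrict.map_comp _ _)
        exact congrArg QMod.restrict.map (QCat.presheafFunctor.map_comp F G) }
    (fun h X φ => QCat.presheafMap_mono h ((toKaroubi Q).obj X) φ)

theorem freeCocompletionLpg_comp_inclusion :
    (freeCocompletionLpg Q).comp (inclusion Q) = freeCocompletion Q :=
  rfl

theorem isBiequivalence_freeCocompletionLpg : IsBiequivalence (freeCocompletionLpg Q) := by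
  refine ⟨principalsFunctor Q, ?_, ?_⟩
  · choose R hR using fun A : OrdSheaf Q => QCat.exists_inverse_yonedaPrincipals A.cauchyComplete
    refine nonempty_equivalence_of_pointwise LocallyOrdered.subsingleton_hom₂
      (fun A => A.cat.yonedaPrincipals)
      (fun F => eqToIso (QCat.yonedaPrincipals_naturality F)) R
      -- This composite is the identity only up to isomorphism, since distinct objects of `A` can
      -- have equal representables; the other is an equality because presheaves are partially
      -- ordered.
      (fun A => LocallyOrdered.isoOfLE (C := OrdSheaf Q) (fun {e} a => ?_) (fun {e} a => ?_))
      (fun A => eqToIso ?_)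
    · exact QCat.id_le_hom_of_yoneda_eq (hR A (A.cat.yonedaPrincipals.app a)).symm
    · exact QCat.id_le_hom_of_yoneda_eq (hR A (A.cat.yonedaPrincipals.app a))
    · exact QCat.Hom.ext (funext fun _ => funext fun p => Subtype.ext (hR A p))
  · refine nonempty_equivalence_of_pointwise LocallyOrdered.subsingleton_hom₂
      (fun M => ⟨M.as.module.principalsCounit, isMap_of_inverse
        (QMod.principalsCounit_comp_nerve _) (QMod.principalsNerve_comp_counit M.as.lpg)⟩)
      (fun α => eqToIso (Subtype.ext (QMod.principalsCounit_naturality α.1 α.2)))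
      (fun M => ⟨M.as.module.principalsNerve, isMap_of_inverse
        (QMod.principalsNerve_comp_counit M.as.lpg) (QMod.principalsCounit_comp_nerve _)⟩)
      (fun M => eqToIso (Subtype.ext (QMod.principalsCounit_comp_nerve _).symm))
      (fun M => eqToIso (Subtype.ext (QMod.principalsNerve_comp_counit M.as.lpg)))

end Biequivalence

end OrderedSheaves

end

theorem theorem19 (Q : Type u) [Category.{u} Q] [Quantaloid Q] :
    IsLeftBiadjoint (freeCocompletion Q) (forgetful Q) ∧
    ∃ E : Pseudofunctor (OrdSheaf Q) (MapModLpg Q),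
      IsBiequivalence E ∧ E.comp (inclusion Q) = freeCocompletion Q :=
  ⟨isLeftBiadjoint_freeCocompletion_forgetful, freeCocompletionLpg Q,
    isBiequivalence_freeCocompletionLpg, freeCocompletionLpg_comp_inclusion⟩
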